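/- For every integer $d\ge 4$ there is a simplicial $d$-polytope $P$ in $\mathbb{R}^d$ whose graph has minimum degree at least $(d^2+d)/2$ and has a minimum edge cut (an edge cut of least cardinality) that is nontrivial and has exactly $(d^2+d)/2$ edges. Here an edge cut of a graph is the set of all edges between $X$ and its complement, for a nonempty proper subset $X$ of the vertices, and it is nontrivial if it is not the set of all edges incident with a single vertex. Moreover, $P$ can be taken of the form $C\#_{F_0}S\#_{F_1}C$, where $S$ is a stacked $d$-polytope with $2d$ vertices, $F_0$ and $F_1$ are disjoint facets of $S$, and $C$ is a neighborly cyclic $d$-polytope (the convex hull of at least $d+1$ points on the moment curve), a copy of which is glued to $S$ along $F_0$ and another along $F_1$. Here a connected sum of $d$-polytopes $P_1$ and $P_2$ along a facet $F$ of $P_1$ is a polytope $P_1\cup P_2'$, where $P_2'$ is a projective image of $P_2$ that has $F$ as a facet and satisfies $P_1\cap P_2'=F$, such that the proper faces of $P_1\cup P_2'$ are exactly the proper faces of $P_1$ and of $P_2'$ other than $F$. A $d$-polytope is stacked if it is a $d$-simplex or a connected sum of a stacked $d$-polytope with a $d$-simplex. Consequently, for $d=4$ the bound $4d-7$ in the theorem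 "every minimum edge cut of cardinality at most $4d-7$ in a simplicial $d$-polytope is trivial" cannot be replaced by $4d-6$: it is not true that every minimum edge cut of cardinality at most $4\cdot 4-6=10$ in a simplicial $4$-polytope is trivial. -/

import Mathlib

noncomputable section

namespace SimpleGraph

variable {V : Type*} (G : SimpleGraph V)

/-- `E(X, Xᶜ)`: the set of all edges of `G` from a vertex in `X` to a vertex outside `X`. -/
def crossingEdges (X : Set V) : Set (Sym2 V) :=
  {e | ∃ x ∈ X, ∃ y ∉ X, G.Adj x y ∧ e = s(x, y)}

/-- An edge cut: a set `E(X, Xᶜ)` with `X` a nonempty proper subset of the vertex set. -/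
def IsEdgeCut (D : Set (Sym2 V)) : Prop :=
  ∃ X : Set V, X.Nonempty ∧ X ≠ Set.univ ∧ D = G.crossingEdges X

/-- A minimum edge cut: an edge cut of least cardinality among all edge cuts. -/
def IsMinimumEdgeCut (D : Set (Sym2 V)) : Prop :=
  G.IsEdgeCut D ∧ ∀ D' : Set (Sym2 V), G.IsEdgeCut D' → D.encard ≤ D'.encard

/-- A set of edges is trivial if it consists of the edges incident with a single vertex. -/
def IsTrivialCut (D : Set (Sym2 V)) : Prop :=
  ∃ v : V, D = G.incidenceSet v

end SimpleGraph

namespace Polytope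

/-- Real Euclidean space of dimension `d`. -/
abbrev Space (d : ℕ) : Type := EuclideanSpace ℝ (Fin d)

variable {d : ℕ}

/-- The dimension of a nonempty convex set (the dimension of its affine hull). -/
def dim (P : Set (Space d)) : ℕ := Module.finrank ℝ (vectorSpan ℝ P)

/-- A `k`-polytope in `ℝ^d`: the convex hull of a finite nonempty set, of dimension `k`. -/
def IsPolytope (k : ℕ) (P : Set (Space d)) : Prop :=
  (∃ s : Finset (Space d), s.Nonempty ∧ P = convexHull ℝ (s : Set (Space d))) ∧ dim P = k

/-- `F` is a face of `P`: `P` itself, the empty set, or the set of points of `P` that lie on a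
supporting hyperplane of `P`, in other words the set of maximizers on `P` of a linear functional. -/
def IsFace (P F : Set (Space d)) : Prop := IsExposed ℝ P F

/-- A proper face: a face other than `P` (the empty face counts as proper). -/
def IsProperFace (P F : Set (Space d)) : Prop := IsFace P F ∧ F ≠ P

/-- A facet: a face whose dimension is one less than that of the polytope. -/
def IsFacet (P F : Set (Space d)) : Prop :=
  IsFace P F ∧ F.Nonempty ∧ dim F + 1 = dim P

/-- The vertices of `P`: the points `v` for which `{v}` is a face of `P`. -/
def vertices (P : Set (Space d)) : Set (Space d) := {v | IsFace P {v}}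

/-- The graph of `P`: two distinct vertices are adjacent when the segment between them is a
face (an edge) of `P`. -/
def graph (P : Set (Space d)) : SimpleGraph (vertices P) where
  Adj u v := u ≠ v ∧ IsFace P (segment ℝ (u : Space d) (v : Space d))
  symm := ⟨fun u v h => ⟨h.1.symm, by rw [segment_symm]; exact h.2⟩⟩
  loopless := ⟨fun _ h => h.1 rfl⟩

/-- A `k`-simplex: the convex hull of `k + 1` affinely independent points. -/
def IsSimplex (k : ℕ) (P : Set (Space d)) : Prop :=
  ∃ p : Fin (k + 1) → Space d, AffineIndependent ℝ p ∧ P = convexHull ℝ (Set.range p)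

/-- A simplicial `k`-polytope: a `k`-polytope all of whose facets are simplices. -/
def IsSimplicial (k : ℕ) (P : Set (Space d)) : Prop :=
  IsPolytope k P ∧ ∀ F : Set (Space d), IsFacet P F → ∃ j : ℕ, IsSimplex j F

/-- `P'` is the image of `P` under a projective transformation of `ℝ^d` that is finite on `P`.
The transformation is given in homogeneous coordinates by a linear automorphism `φ` of
`ℝ^d × ℝ`; it maps `x` to `y / t` where `φ (x, 1) = (y, t)`. As `P` is convex, `t` has constant
sign on `P`, and the sign of `φ` is chosen to make it positive. -/
def IsProjectiveImage (P P' : Set (Space d)) : Prop :=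
  ∃ φ : (Space d × ℝ) ≃ₗ[ℝ] (Space d × ℝ),
    (∀ x ∈ P, 0 < (φ (x, 1)).2) ∧
    P' = (fun x : Space d => ((φ (x, 1)).2)⁻¹ • (φ (x, 1)).1) '' P

/-- `Q` is a connected sum of the polytopes `P` and `P'` along the facet `F` of `P`: some
projective image `P₁` of `P'` has `F` as a facet too, `P` and `P₁` meet exactly in `F`, their
union `Q` is convex, and the proper faces of `Q` are the proper faces of `P` and those of `P₁`,
with the exception of `F`. (The polytope `P` stays in place and `P'` is moved.) -/
def IsConnectedSum (F P P' Q : Set (Space d)) : Prop :=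
  ∃ P₁ : Set (Space d), IsProjectiveImage P' P₁ ∧
    IsFacet P F ∧ IsFacet P₁ F ∧ P ∩ P₁ = F ∧
    Q = P ∪ P₁ ∧ Convex ℝ Q ∧
    ∀ K : Set (Space d),
      IsProperFace Q K ↔ (IsProperFace P K ∨ IsProperFace P₁ K) ∧ K ≠ F

/-- Stacked `d`-polytopes: the `d`-simplices, and the connected sums of a stacked `d`-polytope
with a `d`-simplex along a facet. (The facet is a facet of a simplex, hence a simplex.) -/
inductive IsStacked : Set (Space d) → Prop
  | simplex {T : Set (Space d)} (hT : IsSimplex d T) : IsStacked T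
  | stack {P F T Q : Set (Space d)} (hP : IsStacked P) (hT : IsSimplex d T)
      (hQ : IsConnectedSum F P T Q) : IsStacked Q

/-- The moment curve `t ↦ (t, t², …, t^d)`. -/
def momentCurve (d : ℕ) (t : ℝ) : Space d := WithLp.toLp 2 fun i : Fin d => t ^ (i.val + 1)

/-- A cyclic `d`-polytope: the convex hull of `n ≥ d + 1` distinct points on the moment curve. -/
def IsCyclic (C : Set (Space d)) : Prop :=
  ∃ n : ℕ, d + 1 ≤ n ∧ ∃ t : Fin n → ℝ, StrictMono t ∧
    C = convexHull ℝ (Set.range fun i => momentCurve d (t i))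

/-- A `d`-polytope is neighborly if any `⌊d / 2⌋` or fewer of its vertices are the vertices of
a face. -/
def IsNeighborly (C : Set (Space d)) : Prop :=
  ∀ W : Finset (Space d), (W : Set (Space d)) ⊆ vertices C → W.card ≤ d / 2 →
    IsFace C (convexHull ℝ (W : Set (Space d)))

/-- `P` is of the form `C #_{F₀} S #_{F₁} C`, where `S` is a stacked `d`-polytope with `2d`
vertices, `F₀` and `F₁` are disjoint facets of `S`, and `C` is a neighborly cyclic
`d`-polytope. -/
def IsStackedCyclicSum (P : Set (Space d)) : Prop :=
  ∃ S F₀ F₁ C Q : Set (Space d),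
    IsStacked S ∧ (vertices S).ncard = 2 * d ∧
    IsFacet S F₀ ∧ IsFacet S F₁ ∧ Disjoint F₀ F₁ ∧
    IsCyclic C ∧ IsNeighborly C ∧
    IsConnectedSum F₀ S C Q ∧ IsConnectedSum F₁ Q C P

end Polytope

end

/-! Everything reduces to a graph consisting of two cliques joined by few edges. Put N = (d² + d)/2.
Stacking simplices in a row gives a stacked polytope S with vertices v 0, …, v (2d - 1), where v i
and v j are adjacent exactly when 0 < |i - j| ≤ d (`IsStackedPath`). Its first d and last d vertices
span disjoint facets, and v i in the first half has i + 1 neighbours in the second half, so N edges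
run between the halves. Onto each of the two facets glue a projective copy of a cyclic polytope with
N + 1 vertices. Since d ≥ 4, any two vertices of a cyclic polytope are adjacent, and gluing neither
destroys nor creates edges. The graph of the result is thus two cliques of N + 1 vertices joined by
exactly N edges.

In such a graph all degrees are at least N. A cut that splits one of the cliques has at least N
edges, and the only other cut is the one between the cliques, so that cut is minimum
(`isMinimumEdgeCut_of_cliques`). It is not a star, because every vertex has a neighbour in its own
clique. For d = 4 one gets N = 10 = 4d - 6.

The geometric work is to show that connected sums along simplex facets exist. In homogeneous
coordinates a nonempty face of P is the zero set in P of a linear functional that is nonpositive on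
P. If two polytopes lie on opposite sides of a common simplex facet F, and each lies strictly
beneath all facet hyperplanes of the other except that of F, then their union is convex and has the
required faces (`Gluable`). To reach this position, match the two facets by a linear automorphism
and compose it with a shear that fixes the hyperplane of F and drags all other vertices towards the
barycentre of F. There every other facet functional is strictly negative; these functionals can be
taken finite in number, because the polar cone of a finite set is finitely generated, so one large
shear parameter serves all of them (`exists_gluable`). -/

noncomputable section

open Set

/-! ### Finitely generated cones (Fourier–Motzkin elimination) -/

/-- Cutting a finitely generated cone with a half-space gives a finitely generated cone. -/
theorem PointedCone.exists_finset_hull_inter_halfSpace {W : Type*} [AddCommGroup W] [Module ℝ W]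
    (R : Finset W) (l : W →ₗ[ℝ] ℝ) :
    ∃ R' : Finset W, ∀ x, x ∈ PointedCone.hull ℝ (R' : Set W) ↔
      x ∈ PointedCone.hull ℝ (R : Set W) ∧ l x ≤ 0 := by
  classical
  let Rp := R.filter fun r => 0 < l r
  let Rn := R.filter fun r => l r ≤ 0
  -- Besides the generators already in the half-space, each pair on opposite sides contributes its
  -- positive combination on the hyperplane `l = 0`.
  let R' := Rn ∪ (Rp ×ˢ Rn).image fun q => (-l q.2) • q.1 + l q.1 • q.2
  refine ⟨R', fun x => ⟨fun hx => ?_, fun ⟨hx, hlx⟩ => ?_⟩⟩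
  · induction hx using Submodule.span_induction with
    | mem x hx =>
      simp only [R', Rn, Rp, Finset.coe_union, Finset.coe_filter, Finset.coe_image, mem_union,
        mem_ofPred_eq, mem_image, SetLike.mem_coe, Finset.mem_product, Finset.mem_filter] at hx
      rcases hx with hx | ⟨q, ⟨⟨h1, h2⟩, h3, h4⟩, rfl⟩
      · exact ⟨PointedCone.subset_hull hx.1, hx.2⟩
      · refine ⟨add_mem (PointedCone.smul_mem _ (by linarith) (PointedCone.subset_hull h1))
          (PointedCone.smul_mem _ h2.le (PointedCone.subset_hull h3)), ?_⟩
        simp only [map_add, map_smul, smul_eq_mul]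
        linarith
    | zero => exact ⟨zero_mem _, by simp⟩
    | add x y _ _ hx hy => exact ⟨add_mem hx.1 hy.1, by rw [map_add]; linarith [hx.2, hy.2]⟩
    | smul a x _ hx =>
      refine ⟨Submodule.smul_mem _ a hx.1, ?_⟩
      have : l (a • x) = (a : ℝ) * l x := l.map_smul (a : ℝ) x
      rw [this]
      exact mul_nonpos_of_nonneg_of_nonpos a.2 hx.2
  · have hR : (R : Set W) = (Rp : Set W) ∪ Rn := by
      ext r
      simp only [Rp, Rn, Finset.coe_filter, mem_union, mem_ofPred_eq, Finset.mem_coe]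
      constructor
      · intro h
        rcases lt_or_ge 0 (l r) with h' | h'
        · exact Or.inl ⟨h, h'⟩
        · exact Or.inr ⟨h, h'⟩
      · rintro (h | h) <;> exact h.1
    rw [hR, PointedCone.hull, Submodule.span_union, Submodule.mem_sup] at hx
    obtain ⟨y, hy, z, hz, rfl⟩ := hx
    have hzR : ∀ z ∈ Submodule.span {c : ℝ // 0 ≤ c} (Rn : Set W),
        z ∈ PointedCone.hull ℝ (R' : Set W) := fun z hz =>
      Submodule.span_mono (by simp [R']) hz
    have hsm : ∀ (a : {c : ℝ // 0 ≤ c}) (w : W), l (a • w) = (a : ℝ) * l w :=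
      fun a w => l.map_smul (a : ℝ) w
    have hzn : ∀ z ∈ Submodule.span {c : ℝ // 0 ≤ c} (Rn : Set W), l z ≤ 0 := by
      intro z hz
      induction hz using Submodule.span_induction with
      | mem z hz => exact (Finset.mem_filter.1 hz).2
      | zero => simp
      | add x y _ _ hx hy => rw [map_add]; linarith
      | smul a x _ hx => rw [hsm]; exact mul_nonpos_of_nonneg_of_nonpos a.2 hx
    have hyp : ∀ y ∈ Submodule.span {c : ℝ // 0 ≤ c} (Rp : Set W), 0 ≤ l y ∧ (l y = 0 → y = 0) := by
      intro y hy
      induction hy using Submodule.span_induction with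
      | mem z hz =>
        have := (Finset.mem_filter.1 hz).2
        exact ⟨this.le, fun h => absurd h this.ne'⟩
      | zero => simp
      | add x y _ _ hx hy =>
        rw [map_add]
        refine ⟨by linarith [hx.1, hy.1], fun h => ?_⟩
        rw [hx.2 (by linarith [hx.1, hy.1]), hy.2 (by linarith [hx.1, hy.1]), add_zero]
      | smul a x _ hx =>
        rw [hsm]
        refine ⟨mul_nonneg a.2 hx.1, fun h => ?_⟩
        rcases mul_eq_zero.1 h with h | h
        · have : a = 0 := Subtype.ext h
          rw [this, zero_smul]
        · rw [hx.2 h, smul_zero]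
    -- The expression is bilinear in (y, z), so membership passes from pairs of generators to pairs
    -- of cone elements by a double induction.
    have key : ∀ y ∈ Submodule.span {c : ℝ // 0 ≤ c} (Rp : Set W),
        ∀ z ∈ Submodule.span {c : ℝ // 0 ≤ c} (Rn : Set W),
        (-l z) • y + l y • z ∈ PointedCone.hull ℝ (R' : Set W) := by
      intro y hy z hz
      induction hy using Submodule.span_induction with
      | mem y hy =>
        induction hz using Submodule.span_induction with
        | mem z hz =>
          apply PointedCone.subset_hull
          simp only [R', Finset.coe_union, mem_union, Finset.coe_image, mem_image]
          exact Or.inr ⟨(y, z), by simpa using ⟨hy, hz⟩, rfl⟩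
        | zero => simp
        | add x w _ _ hx hw =>
          convert add_mem hx hw using 1
          rw [map_add]
          module
        | smul a x _ hx =>
          convert PointedCone.smul_mem _ a.2 hx using 1
          rw [hsm]
          change _ + l y • ((a : ℝ) • x) = _
          module
      | zero => simp
      | add x w _ _ hx hw =>
        convert add_mem hx hw using 1
        rw [map_add]
        module
      | smul a x _ hx =>
        convert PointedCone.smul_mem _ a.2 hx using 1
        rw [hsm]
        change (-l z) • ((a : ℝ) • x) + _ = _
        module
    have h1 := hzn z hz
    obtain ⟨h2, h3⟩ := hyp y hy
    rw [map_add] at hlx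
    rcases h1.lt_or_eq with h1 | h1
    -- All of y is absorbed into the combination on `l = 0`; the multiple of z left over is
    -- nonnegative because `l y + l z ≤ 0`.
    · have e : y + z = (-l z)⁻¹ • ((-l z) • y + l y • z) + (1 - l y * (-l z)⁻¹) • z := by
        have : (-l z)⁻¹ * (-l z) = 1 := inv_mul_cancel₀ (by linarith)
        rw [smul_add, smul_smul, smul_smul, this]
        module
      rw [e]
      have h4 : 0 < -l z := by linarith
      refine add_mem (PointedCone.smul_mem _ (by positivity) (key y hy z hz))
        (PointedCone.smul_mem _ ?_ (hzR z hz))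
      rw [sub_nonneg, ← div_eq_mul_inv, div_le_one h4]
      linarith
    · rw [h3 (by linarith), zero_add]
      exact hzR z hz

/-- The whole of a finite-dimensional space is a finitely generated cone. -/
theorem PointedCone.exists_finset_hull_eq_top (W : Type*) [AddCommGroup W] [Module ℝ W]
    [Module.Finite ℝ W] : ∃ R : Finset W, ∀ x, x ∈ PointedCone.hull ℝ (R : Set W) := by
  classical
  obtain ⟨S, hS⟩ := (Module.Finite.fg_top : (⊤ : Submodule ℝ W).FG)
  refine ⟨S ∪ S.image fun x => -x, fun x => ?_⟩
  have hx : x ∈ Submodule.span ℝ (S : Set W) := hS ▸ Submodule.mem_top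
  -- Proved for x and -x together, so that negative scalars can be handled in the induction.
  have : x ∈ PointedCone.hull ℝ ((S ∪ S.image fun x => -x : Finset W) : Set W) ∧
      -x ∈ PointedCone.hull ℝ ((S ∪ S.image fun x => -x : Finset W) : Set W) := by
    induction hx using Submodule.span_induction with
    | mem x hx =>
      constructor <;> apply PointedCone.subset_hull <;> simp_all
    | zero => simp
    | add x y _ _ hx hy => rw [neg_add]; exact ⟨add_mem hx.1 hy.1, add_mem hx.2 hy.2⟩
    | smul a x _ hx =>
      rcases le_total 0 a with ha | ha
      · rw [← smul_neg]
        exact ⟨PointedCone.smul_mem _ ha hx.1, PointedCone.smul_mem _ ha hx.2⟩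
      · have h : a • x = (-a) • (-x) := by module
        have h' : -(a • x) = (-a) • x := by module
        rw [h', h]
        exact ⟨PointedCone.smul_mem _ (by linarith) hx.2, PointedCone.smul_mem _ (by linarith) hx.1⟩
  exact this.1

/-- The polar of a finite set is a finitely generated cone. -/
theorem PointedCone.exists_finset_hull_polar {E : Type*} [AddCommGroup E] [Module ℝ E]
    [FiniteDimensional ℝ E] (V : Finset E) :
    ∃ G : Finset (E →ₗ[ℝ] ℝ), ∀ L, L ∈ PointedCone.hull ℝ (G : Set (E →ₗ[ℝ] ℝ)) ↔
      ∀ v ∈ V, L v ≤ 0 := by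
  classical
  induction V using Finset.induction_on with
  | empty =>
    obtain ⟨R, hR⟩ := PointedCone.exists_finset_hull_eq_top (E →ₗ[ℝ] ℝ)
    exact ⟨R, fun L => by simp [hR]⟩
  | insert v V _ ih =>
    obtain ⟨G, hG⟩ := ih
    obtain ⟨G', hG'⟩ := PointedCone.exists_finset_hull_inter_halfSpace G
      (LinearMap.applyₗ v : (E →ₗ[ℝ] ℝ) →ₗ[ℝ] ℝ)
    refine ⟨G', fun L => ?_⟩
    rw [hG', hG]
    simp [and_comm]

/-! ### Faces in homogeneous coordinates -/

namespace Polytope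

variable {d : ℕ}

/-- The homogeneous coordinates `(x, 1)` of a point `x`. -/
def homog (x : Space d) : Space d × ℝ := (x, 1)

theorem homog_combo {x y : Space d} {a b : ℝ} (hab : a + b = 1) :
    homog (a • x + b • y) = a • homog x + b • homog y := by
  simp [homog, hab]

/-- The extra coordinate absorbs the maximum of the exposing functional, so maximizers become zeros.
The empty face is excluded because `IsExposed` asks nothing of it. -/
theorem isFace_iff {P K : Set (Space d)} (hK : K.Nonempty) :
    IsFace P K ↔ ∃ L : Space d × ℝ →ₗ[ℝ] ℝ,
      (∀ x ∈ P, L (homog x) ≤ 0) ∧ K = {x ∈ P | L (homog x) = 0} := by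
  constructor
  · intro h
    obtain ⟨l, rfl⟩ := h hK
    obtain ⟨k, hk⟩ := hK
    refine ⟨(l : Space d →ₗ[ℝ] ℝ) ∘ₗ LinearMap.fst ℝ _ _ - (l k) • LinearMap.snd ℝ _ _, ?_, ?_⟩
    · intro x hx
      simpa [homog] using hk.2 x hx
    · ext x
      simp only [homog, mem_ofPred_eq, LinearMap.sub_apply, LinearMap.comp_apply,
        LinearMap.fst_apply, LinearMap.smul_apply, LinearMap.snd_apply, smul_eq_mul, mul_one,
        sub_eq_zero, ContinuousLinearMap.coe_coe]
      constructor
      · rintro ⟨h1, h2⟩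
        exact ⟨h1, le_antisymm (hk.2 x h1) (h2 k hk.1)⟩
      · rintro ⟨h1, h2⟩
        exact ⟨h1, fun y hy => h2 ▸ hk.2 y hy⟩
  · rintro ⟨L, hL, rfl⟩ ⟨k, hkP, hk⟩
    refine ⟨LinearMap.toContinuousLinearMap (L ∘ₗ LinearMap.inl ℝ _ _), ?_⟩
    have e : ∀ x, L (homog x) = L (x, 0) + L (0, 1) := fun x => by
      rw [← map_add]
      simp [homog]
    ext x
    simp only [mem_ofPred_eq, LinearMap.coe_toContinuousLinearMap', LinearMap.comp_apply,
      LinearMap.inl_apply]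
    refine and_congr_right fun hx => ⟨fun h y hy => ?_, fun h => ?_⟩
    · have := hL y hy
      rw [e] at this h
      linarith
    · have h1 := h k hkP
      have h2 := hL x hx
      rw [e] at h2 hk ⊢
      linarith

theorem convex_setOf_nonpos (L : Space d × ℝ →ₗ[ℝ] ℝ) :
    Convex ℝ {x : Space d | L (homog x) ≤ 0} := by
  intro x hx y hy a b ha hb hab
  simp only [mem_ofPred_eq] at hx hy ⊢
  rw [homog_combo hab, map_add, map_smul, map_smul, smul_eq_mul, smul_eq_mul]
  nlinarith

theorem nonpos_of_mem_convexHull {V : Set (Space d)} {L : Space d × ℝ →ₗ[ℝ] ℝ}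
    (hL : ∀ v ∈ V, L (homog v) ≤ 0) {x : Space d} (hx : x ∈ convexHull ℝ V) : L (homog x) ≤ 0 :=
  convexHull_min (t := {x | L (homog x) ≤ 0}) hL (convex_setOf_nonpos L) hx

/-- A combination with positive weights of nonpositive values vanishes only if each value does;
hence the points satisfying the claim form a convex set containing `V`. -/
theorem mem_convexHull_of_eq_zero {V : Set (Space d)} {L : Space d × ℝ →ₗ[ℝ] ℝ}
    (hL : ∀ v ∈ V, L (homog v) ≤ 0) {x : Space d} (hx : x ∈ convexHull ℝ V)
    (h0 : L (homog x) = 0) : x ∈ convexHull ℝ {v ∈ V | L (homog v) = 0} := by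
  have hC : Convex ℝ {x : Space d | L (homog x) ≤ 0 ∧
      (L (homog x) = 0 → x ∈ convexHull ℝ {v ∈ V | L (homog v) = 0})} := by
    intro x hx y hy a b ha hb hab
    refine ⟨convex_setOf_nonpos L hx.1 hy.1 ha hb hab, fun h => ?_⟩
    rcases ha.eq_or_lt with rfl | ha'
    · obtain rfl : b = 1 := by linarith
      simp only [zero_smul, one_smul, zero_add] at h ⊢
      exact hy.2 h
    rcases hb.eq_or_lt with rfl | hb'
    · obtain rfl : a = 1 := by linarith
      simp only [zero_smul, one_smul, add_zero] at h ⊢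
      exact hx.2 h
    rw [homog_combo hab, map_add, map_smul, map_smul, smul_eq_mul, smul_eq_mul] at h
    have h1 := hx.1
    have h2 := hy.1
    have h3 : L (homog x) = 0 := by nlinarith
    have h4 : L (homog y) = 0 := by nlinarith
    exact convex_convexHull ℝ _ (hx.2 h3) (hy.2 h4) ha hb hab
  refine (convexHull_min (fun v hv => ?_) hC hx).2 h0
  exact ⟨hL v hv, fun h => subset_convexHull ℝ _ ⟨hv, h⟩⟩

theorem setOf_eq_zero_convexHull {V : Set (Space d)} {L : Space d × ℝ →ₗ[ℝ] ℝ}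
    (hL : ∀ v ∈ V, L (homog v) ≤ 0) :
    {x ∈ convexHull ℝ V | L (homog x) = 0} = convexHull ℝ {v ∈ V | L (homog v) = 0} := by
  refine Subset.antisymm (fun x hx => mem_convexHull_of_eq_zero hL hx.1 hx.2) fun x hx => ?_
  have hxV : x ∈ convexHull ℝ V := convexHull_mono (fun v hv => hv.1) hx
  refine ⟨hxV, le_antisymm ?_ ?_⟩
  · exact nonpos_of_mem_convexHull hL hxV
  · have := nonpos_of_mem_convexHull (L := -L) (V := {v ∈ V | L (homog v) = 0})
      (fun v hv => by simp [hv.2]) hx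
    simpa using this

theorem exists_separating {V : Set (Space d)} (hV : V.Finite) {x : Space d}
    (hx : x ∉ convexHull ℝ V) :
    ∃ L : Space d × ℝ →ₗ[ℝ] ℝ, (∀ v ∈ V, L (homog v) ≤ 0) ∧ 0 < L (homog x) := by
  obtain ⟨f, c, h1, h2⟩ := geometric_hahn_banach_closed_point (convex_convexHull ℝ V)
    (hV.isCompact_convexHull (𝕜 := ℝ)).isClosed hx
  refine ⟨(f : Space d →ₗ[ℝ] ℝ) ∘ₗ LinearMap.fst ℝ _ _ - c • LinearMap.snd ℝ _ _, ?_, ?_⟩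
  · intro v hv
    have := h1 v (subset_convexHull ℝ V hv)
    simp [homog]
    linarith
  · simp [homog]
    linarith

theorem affineIndependent_iff_homog {ι : Type*} {p : ι → Space d} :
    AffineIndependent ℝ p ↔ LinearIndependent ℝ fun i => homog (p i) := by
  have hsum : ∀ (s : Finset ι) (w : ι → ℝ),
      ∑ i ∈ s, w i • homog (p i) = (∑ i ∈ s, w i • p i, ∑ i ∈ s, w i) := fun s w => by
    simp [homog, Prod.ext_iff, Prod.fst_sum, Prod.snd_sum]
  rw [affineIndependent_iff, linearIndependent_iff']
  simp only [hsum, Prod.mk_eq_zero]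
  exact ⟨fun h s w hw => h s w hw.2 hw.1, fun h s w h1 h2 => h s w ⟨h2, h1⟩⟩

theorem finrank_homog : Module.finrank ℝ (Space d × ℝ) = d + 1 := by
  simp [Module.finrank_prod]

theorem dim_convexHull (s : Set (Space d)) : dim (convexHull ℝ s) = dim s := by
  rw [dim, dim, ← direction_affineSpan, affineSpan_convexHull, direction_affineSpan]

theorem dim_convexHull_range {k : ℕ} {p : Fin (k + 1) → Space d} (hp : AffineIndependent ℝ p) :
    dim (convexHull ℝ (range p)) = k := by
  rw [dim_convexHull]
  exact hp.finrank_vectorSpan (by simp)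

theorem dim_eq_of_subset {p : Fin (d + 1) → Space d} (hp : AffineIndependent ℝ p)
    {P : Set (Space d)} (h : range p ⊆ P) : dim P = d := by
  have h1 : vectorSpan ℝ (range p) = ⊤ :=
    hp.vectorSpan_eq_top_of_card_eq_finrank_add_one (by simp)
  have h2 : vectorSpan ℝ P = ⊤ := top_le_iff.1 (h1 ▸ vectorSpan_mono ℝ h)
  rw [dim, h2]
  simp

theorem linearIndependent_snoc_homog {n : ℕ} {u : Fin n → Space d} (hu : AffineIndependent ℝ u)
    {h : Space d × ℝ →ₗ[ℝ] ℝ} (h0 : ∀ i, h (homog (u i)) = 0) {w : Space d × ℝ} (hw : h w ≠ 0) :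
    LinearIndependent ℝ (Fin.snoc (fun i => homog (u i)) w : Fin (n + 1) → Space d × ℝ) := by
  rw [affineIndependent_iff_homog] at hu
  rw [linearIndependent_finSnoc]
  refine ⟨hu, fun hs => hw ?_⟩
  have : Submodule.span ℝ (range fun i => homog (u i)) ≤ LinearMap.ker h := by
    rw [Submodule.span_le]
    rintro _ ⟨i, rfl⟩
    exact h0 i
  exact this hs

/-- Adding a point off a hyperplane to affinely independent points on it. -/
theorem affineIndependent_snoc {n : ℕ} {u : Fin n → Space d}
    (hu : AffineIndependent ℝ u) {h : Space d × ℝ →ₗ[ℝ] ℝ} (h0 : ∀ i, h (homog (u i)) = 0)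
    {a : Space d} (ha : h (homog a) ≠ 0) :
    AffineIndependent ℝ (Fin.snoc u a : Fin (n + 1) → Space d) := by
  rw [affineIndependent_iff_homog]
  convert linearIndependent_snoc_homog hu h0 ha using 1
  ext i : 1
  refine Fin.lastCases ?_ (fun i => ?_) i <;> simp

/-! ### Gluing two polytopes along a simplex facet -/

/-- Every functional that is nonpositive on `range u ∪ A` is a nonnegative multiple of `h` plus
a functional that is zero or negative on `B` and in the relative interior of the simplex `u`. So
all facet hyperplanes other than `h = 0` have `B` strictly beneath them. -/
def Beneath {n : ℕ} (u : Fin n → Space d) (A : Set (Space d)) (h : Space d × ℝ →ₗ[ℝ] ℝ)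
    (B : Set (Space d)) : Prop :=
  ∀ L : Space d × ℝ →ₗ[ℝ] ℝ, (∀ v ∈ range u ∪ A, L (homog v) ≤ 0) →
    ∃ (c : ℝ) (s : Space d × ℝ →ₗ[ℝ] ℝ), 0 ≤ c ∧ L = c • h + s ∧
      (∀ v ∈ range u ∪ A, s (homog v) ≤ 0) ∧
      (s = 0 ∨ (∀ b ∈ B, s (homog b) < 0) ∧ s (∑ i, homog (u i)) < 0)

/-- The hypotheses under which the polytopes spanned by `range u ∪ A` and `range u ∪ B`, on
different sides of the hyperplane `h = 0` of the simplex `u`, can be glued. -/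
structure Gluable (u : Fin d → Space d) (A B : Set (Space d))
    (h : Space d × ℝ →ₗ[ℝ] ℝ) : Prop where
  finite_left : A.Finite
  finite_right : B.Finite
  nonempty_left : A.Nonempty
  nonempty_right : B.Nonempty
  pos : 0 < d
  indep : AffineIndependent ℝ u
  eq_zero : ∀ i, h (homog (u i)) = 0
  neg_left : ∀ a ∈ A, h (homog a) < 0
  pos_right : ∀ b ∈ B, 0 < h (homog b)
  beneath_left : Beneath u A h B
  beneath_right : Beneath u B (-h) A

namespace Gluable

variable {u : Fin d → Space d} {A B : Set (Space d)} {h : Space d × ℝ →ₗ[ℝ] ℝ}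

theorem symm (H : Gluable u A B h) : Gluable u B A (-h) where
  finite_left := H.finite_right
  finite_right := H.finite_left
  nonempty_left := H.nonempty_right
  nonempty_right := H.nonempty_left
  pos := H.pos
  indep := H.indep
  eq_zero i := by simp [H.eq_zero]
  neg_left a ha := by simpa using H.pos_right a ha
  pos_right b hb := by simpa using H.neg_left b hb
  beneath_left := H.beneath_right
  beneath_right := by simpa using H.beneath_left

theorem nonpos_left (H : Gluable u A B h) : ∀ v ∈ range u ∪ A, h (homog v) ≤ 0 := by
  rintro _ (⟨i, rfl⟩ | ha)
  · exact (H.eq_zero i).le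
  · exact (H.neg_left _ ha).le

theorem face_eq (H : Gluable u A B h) :
    {x ∈ convexHull ℝ (range u ∪ A) | h (homog x) = 0} = convexHull ℝ (range u) := by
  rw [setOf_eq_zero_convexHull H.nonpos_left]
  congr 1
  ext x
  constructor
  · rintro ⟨hx | hx, h0⟩
    · exact hx
    · exact absurd h0 (H.neg_left x hx).ne
  · rintro ⟨i, rfl⟩
    exact ⟨Or.inl ⟨i, rfl⟩, H.eq_zero i⟩

theorem nonempty_range (H : Gluable u A B h) : (range u).Nonempty :=
  ⟨u ⟨0, H.pos⟩, mem_range_self _⟩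

theorem dim_left (H : Gluable u A B h) : dim (convexHull ℝ (range u ∪ A)) = d := by
  obtain ⟨a, ha⟩ := H.nonempty_left
  refine dim_eq_of_subset
    (affineIndependent_snoc H.indep H.eq_zero (H.neg_left a ha).ne) ?_
  rintro _ ⟨i, rfl⟩
  apply subset_convexHull
  refine Fin.lastCases ?_ (fun i => ?_) i
  · simpa using Or.inr ha
  · simp

theorem isFacet_left (H : Gluable u A B h) :
    IsFacet (convexHull ℝ (range u ∪ A)) (convexHull ℝ (range u)) := by
  have hne : (convexHull ℝ (range u)).Nonempty := H.nonempty_range.convexHull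
  refine ⟨(isFace_iff hne).2 ⟨h, fun x hx => nonpos_of_mem_convexHull H.nonpos_left hx,
    H.face_eq.symm⟩, hne, ?_⟩
  rw [H.dim_left]
  obtain ⟨n, rfl⟩ : ∃ n, d = n + 1 := ⟨d - 1, (Nat.sub_add_cancel H.pos).symm⟩
  rw [dim_convexHull_range H.indep]

/-- The heart of convexity of the union. A functional separating x from the left polytope splits as
`c • h + s`; the term s is nonpositive on both polytopes and `c * h` is nonpositive at x, so nothing
separates. -/
theorem mem_left (H : Gluable u A B h) {x : Space d} (hx : h (homog x) ≤ 0)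
    (hs : x ∈ convexHull ℝ (range u ∪ A ∪ B)) : x ∈ convexHull ℝ (range u ∪ A) := by
  by_contra hn
  obtain ⟨L, hL, hLx⟩ := exists_separating ((finite_range u).union H.finite_left) hn
  obtain ⟨c, s, hc, rfl, hsA, hsB⟩ := H.beneath_left L hL
  have h1 : s (homog x) ≤ 0 := by
    refine nonpos_of_mem_convexHull (fun v hv => ?_) hs
    rcases hv with hv | hv
    · exact hsA v hv
    · rcases hsB with rfl | hsB
      · simp
      · exact (hsB.1 v hv).le
  simp only [LinearMap.add_apply, LinearMap.smul_apply, smul_eq_mul] at hLx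
  nlinarith

theorem union_eq (H : Gluable u A B h) :
    convexHull ℝ (range u ∪ A) ∪ convexHull ℝ (range u ∪ B) =
      convexHull ℝ (range u ∪ A ∪ B) := by
  have e : range u ∪ B ∪ A = range u ∪ A ∪ B := by rw [union_assoc, union_comm B, ← union_assoc]
  apply Subset.antisymm
  · refine union_subset (convexHull_mono subset_union_left) (convexHull_mono ?_)
    rw [← e]
    exact subset_union_left
  · intro x hx
    rcases le_total (h (homog x)) 0 with h0 | h0
    · exact Or.inl (H.mem_left h0 hx)
    · exact Or.inr (H.symm.mem_left (by simpa using h0) (e.symm ▸ hx))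

theorem inter_eq (H : Gluable u A B h) :
    convexHull ℝ (range u ∪ A) ∩ convexHull ℝ (range u ∪ B) = convexHull ℝ (range u) := by
  apply Subset.antisymm
  · intro x hx
    have h1 := nonpos_of_mem_convexHull H.nonpos_left hx.1
    have h2 := nonpos_of_mem_convexHull H.symm.nonpos_left hx.2
    rw [← H.face_eq]
    refine ⟨hx.1, le_antisymm h1 ?_⟩
    simpa using h2
  · exact subset_inter (convexHull_mono subset_union_left) (convexHull_mono subset_union_left)

theorem neg_of_pos (H : Gluable u A B h) {s : Space d × ℝ →ₗ[ℝ] ℝ}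
    (hu : ∀ v ∈ range u, s (homog v) ≤ 0) (hB : ∀ b ∈ B, s (homog b) < 0) {y : Space d}
    (hy : y ∈ convexHull ℝ (range u ∪ B)) (hhy : 0 < h (homog y)) : s (homog y) < 0 := by
  have hs : ∀ v ∈ range u ∪ B, s (homog v) ≤ 0 := by
    rintro v (hv | hv)
    · exact hu v hv
    · exact (hB v hv).le
  refine lt_of_le_of_ne (nonpos_of_mem_convexHull hs hy) fun h0 => ?_
  have h1 := mem_convexHull_of_eq_zero hs hy h0
  have h2 : y ∈ convexHull ℝ (range u) := by
    refine convexHull_mono ?_ h1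
    rintro v ⟨hv | hv, hv0⟩
    · exact hv
    · exact absurd hv0 (hB v hv).ne
  rw [← H.face_eq] at h2
  linarith [h2.2]

/-- No proper face of the union has points strictly on both sides of the gluing hyperplane: the zero
at x forces `c = 0`, and the zero at y then contradicts strict negativity of s unless `s = 0`. -/
theorem eq_zero_of_both_sides (H : Gluable u A B h) {L : Space d × ℝ →ₗ[ℝ] ℝ}
    (hL : ∀ v ∈ range u ∪ A, L (homog v) ≤ 0) {x y : Space d}
    (hx : x ∈ convexHull ℝ (range u ∪ A)) (hhx : h (homog x) < 0) (hLx : L (homog x) = 0)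
    (hy : y ∈ convexHull ℝ (range u ∪ B)) (hhy : 0 < h (homog y)) (hLy : L (homog y) = 0) :
    L = 0 := by
  obtain ⟨c, s, hc, rfl, hsA, hsB⟩ := H.beneath_left L hL
  have h1 := nonpos_of_mem_convexHull hsA hx
  simp only [LinearMap.add_apply, LinearMap.smul_apply, smul_eq_mul] at hLx hLy
  obtain rfl : c = 0 := by nlinarith
  rcases hsB with rfl | hsB
  · simp
  · have := H.neg_of_pos (fun v hv => hsA v (Or.inl hv)) hsB.1 hy hhy
    linarith

theorem eq_zero_sum (L : Space d × ℝ →ₗ[ℝ] ℝ)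
    (hL : ∀ x ∈ convexHull ℝ (range u), L (homog x) = 0) : L (∑ i, homog (u i)) = 0 := by
  rw [map_sum]
  exact Finset.sum_eq_zero fun i _ => hL _ (subset_convexHull ℝ _ ⟨i, rfl⟩)

/-- If the face contained the glued simplex, the functional would vanish at the sum of its vertices;
this forces `s = 0`, so `L` would be a positive multiple of `h`, which is positive on `B`. -/
theorem isProperFace_left (H : Gluable u A B h) {L : Space d × ℝ →ₗ[ℝ] ℝ}
    (hL : ∀ v ∈ range u ∪ A ∪ B, L (homog v) ≤ 0) {K : Set (Space d)} (hKn : K.Nonempty)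
    (hK : K = {x ∈ convexHull ℝ (range u ∪ A ∪ B) | L (homog x) = 0})
    (hKQ : K ≠ convexHull ℝ (range u ∪ A ∪ B)) (hKP : ∀ x ∈ K, h (homog x) ≤ 0) :
    IsProperFace (convexHull ℝ (range u ∪ A)) K ∧ K ≠ convexHull ℝ (range u) := by
  have hLA : ∀ v ∈ range u ∪ A, L (homog v) ≤ 0 := fun v hv => hL v (Or.inl hv)
  have hL0 : L ≠ 0 := fun h0 => hKQ (by rw [hK, h0]; simp)
  have hsub : K ⊆ convexHull ℝ (range u ∪ A) := fun x hx => H.mem_left (hKP x hx) (hK ▸ hx).1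
  have hKe : K = {x ∈ convexHull ℝ (range u ∪ A) | L (homog x) = 0} := by
    ext x
    constructor
    · intro hx
      exact ⟨hsub hx, (hK ▸ hx).2⟩
    · intro hx
      rw [hK]
      exact ⟨convexHull_mono subset_union_left hx.1, hx.2⟩
  have hnot : ¬ convexHull ℝ (range u) ⊆ K ∨ ∃ c : ℝ, 0 < c ∧ L = c • h := by
    by_cases hF : convexHull ℝ (range u) ⊆ K
    · right
      obtain ⟨c, s, hc, hLs, hsA, hsB⟩ := H.beneath_left L hLA
      have h1 : L (∑ i, homog (u i)) = 0 := eq_zero_sum L fun x hx => (hKe ▸ hF hx).2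
      have h2 : h (∑ i, homog (u i)) = 0 := by simp [H.eq_zero]
      rcases hsB with rfl | hsB
      · refine ⟨c, hc.lt_of_ne ?_, by simpa using hLs⟩
        rintro rfl
        exact hL0 (by simpa using hLs)
      · have h3 := hsB.2
        rw [hLs, LinearMap.add_apply, LinearMap.smul_apply, h2, smul_zero, zero_add] at h1
        linarith
    · exact Or.inl hF
  have hnot' : ¬ convexHull ℝ (range u) ⊆ K := by
    rcases hnot with hnot | ⟨c, hc, rfl⟩
    · exact hnot
    · exfalso
      obtain ⟨b, hb⟩ := H.nonempty_right
      have h1 := hL b (Or.inr hb)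
      have h2 := H.pos_right b hb
      simp only [LinearMap.smul_apply, smul_eq_mul] at h1
      nlinarith
  refine ⟨⟨(isFace_iff hKn).2 ⟨L, fun x hx => nonpos_of_mem_convexHull hLA hx, hKe⟩, ?_⟩, ?_⟩
  · intro e
    exact hnot' (e ▸ convexHull_mono subset_union_left)
  · intro e
    exact hnot' e.ge

/-- The functional `c • h + s` may be positive on the other polytope, so it is tilted to `s + ε • h`
with ε small. The zero set on the left is unchanged provided ε vanishes exactly when c does. -/
theorem isProperFace_of_left (H : Gluable u A B h) {K : Set (Space d)} (hKn : K.Nonempty)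
    (hK : IsProperFace (convexHull ℝ (range u ∪ A)) K) (hKF : K ≠ convexHull ℝ (range u)) :
    IsProperFace (convexHull ℝ (range u ∪ A ∪ B)) K := by
  obtain ⟨hKf, hKP⟩ := hK
  obtain ⟨L, hL, hKe⟩ := (isFace_iff hKn).1 hKf
  obtain ⟨c, s, hc, rfl, hsA, hsB⟩ :=
    H.beneath_left L fun v hv => hL v (subset_convexHull ℝ _ hv)
  have hhP := fun x hx => nonpos_of_mem_convexHull H.nonpos_left (x := x) hx
  have hsP := fun x hx => nonpos_of_mem_convexHull hsA (x := x) hx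
  have hs : (∀ b ∈ B, s (homog b) < 0) ∧ s (∑ i, homog (u i)) < 0 := by
    rcases hsB with rfl | hs
    · exfalso
      rcases hc.eq_or_lt with rfl | hc
      · exact hKP (by rw [hKe]; simp)
      · apply hKF
        rw [hKe, ← H.face_eq]
        ext x
        simp [hc.ne']
    · exact hs
  have hKh : ∀ x ∈ K, s (homog x) = 0 ∧ (c = 0 ∨ h (homog x) = 0) := by
    intro x hx
    rw [hKe] at hx
    obtain ⟨hxP, hx0⟩ := hx
    simp only [LinearMap.add_apply, LinearMap.smul_apply, smul_eq_mul] at hx0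
    have h1 := hhP x hxP
    have h2 := hsP x hxP
    have h3 : c * h (homog x) ≤ 0 := mul_nonpos_of_nonneg_of_nonpos hc h1
    exact ⟨by linarith, mul_eq_zero.1 (by linarith)⟩
  -- A small ε exists because s is strictly negative on the finite set `B`.
  have hε : ∃ ε : ℝ, 0 ≤ ε ∧ (c = 0 → ε = 0) ∧ (0 < c → 0 < ε) ∧
      ∀ b ∈ B, s (homog b) + ε * h (homog b) < 0 := by
    rcases hc.eq_or_lt with rfl | hc
    · exact ⟨0, le_rfl, by simp, by simp, fun b hb => by simpa using hs.1 b hb⟩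
    · have : ∀ᶠ ε : ℝ in nhdsWithin 0 (Ioi 0), ∀ b ∈ B, s (homog b) + ε * h (homog b) < 0 := by
        rw [Filter.eventually_all_finite H.finite_right]
        intro b hb
        have hcont : Filter.Tendsto (fun ε : ℝ => s (homog b) + ε * h (homog b))
            (nhdsWithin 0 (Ioi 0)) (nhds (s (homog b) + 0 * h (homog b))) :=
          (Continuous.tendsto (by fun_prop) 0).mono_left nhdsWithin_le_nhds
        exact hcont.eventually_lt_const (by simpa using hs.1 b hb)
      obtain ⟨ε, h1, h2⟩ := (this.and self_mem_nhdsWithin).exists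
      exact ⟨ε, le_of_lt h2, fun h => absurd h hc.ne', fun _ => h2, h1⟩
  obtain ⟨ε, hε0, hεc, hεc', hεB⟩ := hε
  let L' := s + ε • h
  have hL'P : ∀ x ∈ convexHull ℝ (range u ∪ A), L' (homog x) ≤ 0 := fun x hx => by
    have h1 := hhP x hx
    have h2 := hsP x hx
    simp only [L', LinearMap.add_apply, LinearMap.smul_apply, smul_eq_mul]
    nlinarith
  have hL'B : ∀ b ∈ B, L' (homog b) < 0 := fun b hb => by simpa [L'] using hεB b hb
  have hL'u : ∀ v ∈ range u, L' (homog v) ≤ 0 := fun v hv =>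
    hL'P v (subset_convexHull ℝ _ (Or.inl hv))
  refine ⟨(isFace_iff hKn).2 ⟨L', fun x hx => nonpos_of_mem_convexHull ?_ hx, ?_⟩, ?_⟩
  · rintro v (hv | hv)
    · exact hL'P v (subset_convexHull ℝ _ hv)
    · exact (hL'B v hv).le
  · ext x
    constructor
    · intro hx
      refine ⟨convexHull_mono subset_union_left (hKe ▸ hx).1, ?_⟩
      obtain ⟨h1, h2⟩ := hKh x hx
      simp only [L', LinearMap.add_apply, LinearMap.smul_apply, smul_eq_mul, h1]
      rcases h2 with h2 | h2
      · simp [hεc h2]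
      · simp [h2]
    · rintro ⟨hx, hx0⟩
      rcases lt_or_ge 0 (h (homog x)) with h0 | h0
      · exfalso
        have hx1 : x ∈ convexHull ℝ (range u ∪ B) := by
          have e : range u ∪ B ∪ A = range u ∪ A ∪ B := by
            rw [union_assoc, union_comm B, ← union_assoc]
          refine H.symm.mem_left ?_ (e.symm ▸ hx)
          simpa using h0.le
        exact (H.neg_of_pos hL'u hL'B hx1 h0).ne hx0
      · have hx1 := H.mem_left h0 hx
        have h2 := hsP x hx1
        simp only [L', LinearMap.add_apply, LinearMap.smul_apply, smul_eq_mul] at hx0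
        have h3 : ε * h (homog x) ≤ 0 := mul_nonpos_of_nonneg_of_nonpos hε0 h0
        have h4 : s (homog x) = 0 := by linarith
        have h5 : ε * h (homog x) = 0 := by linarith
        rw [hKe]
        refine ⟨hx1, ?_⟩
        simp only [LinearMap.add_apply, LinearMap.smul_apply, smul_eq_mul, h4]
        rcases mul_eq_zero.1 h5 with h5 | h5
        · rcases hc.eq_or_lt with h6 | h6
          · simp [← h6]
          · exact absurd h5 (hεc' h6).ne'
        · simp [h5]
  · intro e
    obtain ⟨b, hb⟩ := H.nonempty_right
    have hbK : b ∈ K := e ▸ subset_convexHull ℝ _ (Or.inr hb)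
    rw [hKe] at hbK
    linarith [hhP b hbK.1, H.pos_right b hb]

theorem isProperFace_iff (H : Gluable u A B h) (K : Set (Space d)) :
    IsProperFace (convexHull ℝ (range u ∪ A) ∪ convexHull ℝ (range u ∪ B)) K ↔
      (IsProperFace (convexHull ℝ (range u ∪ A)) K ∨
        IsProperFace (convexHull ℝ (range u ∪ B)) K) ∧ K ≠ convexHull ℝ (range u) := by
  have e : range u ∪ B ∪ A = range u ∪ A ∪ B := by rw [union_assoc, union_comm B, ← union_assoc]
  have hF : (convexHull ℝ (range u)).Nonempty := H.nonempty_range.convexHull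
  rw [H.union_eq]
  rcases K.eq_empty_or_nonempty with rfl | hKn
  · have hne : ∀ s : Set (Space d), s.Nonempty → IsProperFace s ∅ := fun s hs =>
      ⟨isExposed_empty, hs.ne_empty.symm⟩
    have h1 := hne _ ((H.nonempty_range.mono (subset_union_left (t := A))).convexHull (𝕜 := ℝ))
    have h2 := hne _ ((H.nonempty_range.mono
      (subset_union_left.trans (subset_union_left (s := range u ∪ A) (t := B)))).convexHull (𝕜 := ℝ))
    exact ⟨fun _ => ⟨Or.inl h1, hF.ne_empty.symm⟩, fun _ => h2⟩
  constructor
  · rintro ⟨hK, hKQ⟩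
    obtain ⟨L, hL, hKe⟩ := (isFace_iff hKn).1 hK
    have hLV : ∀ v ∈ range u ∪ A ∪ B, L (homog v) ≤ 0 :=
      fun v hv => hL v (subset_convexHull ℝ _ hv)
    by_cases h1 : ∀ x ∈ K, h (homog x) ≤ 0
    · obtain ⟨h2, h3⟩ := H.isProperFace_left hLV hKn hKe hKQ h1
      exact ⟨Or.inl h2, h3⟩
    by_cases h2 : ∀ x ∈ K, 0 ≤ h (homog x)
    · obtain ⟨h2, h3⟩ := H.symm.isProperFace_left (K := K) (e.symm ▸ hLV) hKn (e.symm ▸ hKe)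
        (e.symm ▸ hKQ) (fun x hx => by simpa using h2 x hx)
      exact ⟨Or.inr h2, h3⟩
    · exfalso
      push Not at h1 h2
      obtain ⟨y, hyK, hy⟩ := h1
      obtain ⟨x, hxK, hx⟩ := h2
      rw [hKe] at hyK hxK
      have := H.eq_zero_of_both_sides (fun v hv => hLV v (Or.inl hv))
        (H.mem_left hx.le hxK.1) hx hxK.2
        (H.symm.mem_left (by simpa using hy.le) (e.symm ▸ hyK.1)) hy hyK.2
      exact hKQ (by rw [hKe, this]; simp)
  · rintro ⟨hK | hK, hKF⟩
    · exact H.isProperFace_of_left hKn hK hKF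
    · rw [← e]
      exact H.symm.isProperFace_of_left hKn hK hKF

end Gluable

/-! ### Projective maps -/

/-- The projective map given by a linear automorphism in homogeneous coordinates. -/
def proj (φ : (Space d × ℝ) ≃ₗ[ℝ] (Space d × ℝ)) (x : Space d) : Space d :=
  ((φ (x, 1)).2)⁻¹ • (φ (x, 1)).1

theorem homog_proj {φ : (Space d × ℝ) ≃ₗ[ℝ] (Space d × ℝ)} {x : Space d}
    (hx : (φ (homog x)).2 ≠ 0) : homog (proj φ x) = ((φ (homog x)).2)⁻¹ • φ (homog x) := by
  rw [Prod.ext_iff]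
  exact ⟨rfl, (inv_mul_cancel₀ hx).symm⟩

theorem symm_homog_proj {φ : (Space d × ℝ) ≃ₗ[ℝ] (Space d × ℝ)} {x : Space d}
    (hx : (φ (homog x)).2 ≠ 0) :
    φ.symm (homog (proj φ x)) = ((φ (homog x)).2)⁻¹ • homog x := by
  rw [homog_proj hx, map_smul, LinearEquiv.symm_apply_apply]

theorem proj_symm_proj {φ : (Space d × ℝ) ≃ₗ[ℝ] (Space d × ℝ)} {x : Space d}
    (hx : (φ (homog x)).2 ≠ 0) : proj φ.symm (proj φ x) = x := by
  have h := symm_homog_proj hx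
  rw [proj, ← homog, h]
  simp only [homog] at hx ⊢
  simp [smul_smul, hx]

theorem symm_pos {φ : (Space d × ℝ) ≃ₗ[ℝ] (Space d × ℝ)} {x : Space d}
    (hx : 0 < (φ (homog x)).2) : 0 < (φ.symm (homog (proj φ x))).2 := by
  rw [symm_homog_proj hx.ne']
  simpa [homog] using hx

theorem pos_of_mem_convexHull {φ : (Space d × ℝ) ≃ₗ[ℝ] (Space d × ℝ)} {V : Set (Space d)}
    (hV : ∀ v ∈ V, 0 < (φ (homog v)).2) {x : Space d} (hx : x ∈ convexHull ℝ V) :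
    0 < (φ (homog x)).2 := by
  have hC : Convex ℝ {x : Space d | 0 < (φ (homog x)).2} := by
    intro x hx y hy a b ha hb hab
    simp only [mem_ofPred_eq] at hx hy ⊢
    rw [homog_combo hab, map_add, map_smul, map_smul]
    simp only [Prod.snd_add, Prod.smul_snd, smul_eq_mul]
    rcases ha.eq_or_lt with rfl | ha'
    · obtain rfl : b = 1 := by linarith
      simpa using hy
    · have := mul_pos ha' hx
      have := mul_nonneg hb hy.le
      linarith
  exact convexHull_min (t := {x : Space d | 0 < (φ (homog x)).2}) hV hC hx

theorem proj_mem_convexHull {φ : (Space d × ℝ) ≃ₗ[ℝ] (Space d × ℝ)} {V : Set (Space d)}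
    (hV : ∀ v ∈ V, 0 < (φ (homog v)).2) {x : Space d} (hx : x ∈ convexHull ℝ V) :
    proj φ x ∈ convexHull ℝ (proj φ '' V) := by
  by_contra hn
  have hC : Convex ℝ {x : Space d | 0 < (φ (homog x)).2 ∧
      proj φ x ∈ convexHull ℝ (proj φ '' V)} := by
    rintro x ⟨hx, hx'⟩ y ⟨hy, hy'⟩ a b ha hb hab
    have e : φ (homog (a • x + b • y)) = a • φ (homog x) + b • φ (homog y) := by
      rw [homog_combo hab, map_add, map_smul, map_smul]
    have ht : 0 < (φ (homog (a • x + b • y))).2 := by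
      refine pos_of_mem_convexHull (V := {x, y}) (by simp [hx, hy]) ?_
      exact convex_convexHull ℝ _ (subset_convexHull ℝ _ (by simp))
        (subset_convexHull ℝ _ (by simp)) ha hb hab
    refine ⟨ht, ?_⟩
    -- A projective map carries convex combinations to convex combinations, with the weights
    -- rescaled by the last homogeneous coordinates and normalized by their total.
    have e1 : proj φ (a • x + b • y) =
        (a * (φ (homog x)).2 / (φ (homog (a • x + b • y))).2) • proj φ x +
        (b * (φ (homog y)).2 / (φ (homog (a • x + b • y))).2) • proj φ y := by
      set t := (φ (homog (a • x + b • y))).2 with hteq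
      have h1 : proj φ (a • x + b • y) = t⁻¹ • (φ (homog (a • x + b • y))).1 := rfl
      have h2 : proj φ x = ((φ (homog x)).2)⁻¹ • (φ (homog x)).1 := rfl
      have h3 : proj φ y = ((φ (homog y)).2)⁻¹ • (φ (homog y)).1 := rfl
      rw [h1, h2, h3, e, smul_smul, smul_smul]
      simp only [Prod.fst_add, Prod.smul_fst, smul_add, smul_smul]
      congr 2
      · field_simp
      · field_simp
    rw [e1]
    refine convex_convexHull ℝ _ hx' hy' (by positivity) (by positivity) ?_
    rw [← add_div, div_eq_one_iff_eq ht.ne', e]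
    simp
  exact hn (convexHull_min (t := {x : Space d | 0 < (φ (homog x)).2 ∧
      proj φ x ∈ convexHull ℝ (proj φ '' V)})
    (fun v hv => ⟨hV v hv, subset_convexHull ℝ _ ⟨v, hv, rfl⟩⟩) hC hx).2

theorem proj_image_convexHull {φ : (Space d × ℝ) ≃ₗ[ℝ] (Space d × ℝ)} {V : Set (Space d)}
    (hV : ∀ v ∈ V, 0 < (φ (homog v)).2) :
    proj φ '' convexHull ℝ V = convexHull ℝ (proj φ '' V) := by
  apply Subset.antisymm
  · rintro _ ⟨x, hx, rfl⟩
    exact proj_mem_convexHull hV hx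
  · intro y hy
    have hV' : ∀ v ∈ proj φ '' V, 0 < (φ.symm (homog v)).2 := by
      rintro _ ⟨v, hv, rfl⟩
      exact symm_pos (hV v hv)
    have h1 := proj_mem_convexHull hV' hy
    have h2 : proj φ.symm '' (proj φ '' V) = V := by
      rw [image_image]
      conv_rhs => rw [← image_id V]
      exact image_congr fun v hv => proj_symm_proj (hV v hv).ne'
    rw [h2] at h1
    refine ⟨_, h1, ?_⟩
    have h3 := proj_symm_proj (φ := φ.symm) (pos_of_mem_convexHull hV' hy).ne'
    simpa using h3

/-! ### Moving a polytope into gluing position -/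

theorem mem_hull_neg {E : Type*} [AddCommGroup E] [Module ℝ E] {G : Set (E →ₗ[ℝ] ℝ)}
    {s : E →ₗ[ℝ] ℝ} (hs : s ∈ PointedCone.hull ℝ G) :
    (∀ x, (∀ g ∈ G, g x ≤ 0) → s x ≤ 0) ∧ (s = 0 ∨ ∀ x, (∀ g ∈ G, g x < 0) → s x < 0) := by
  induction hs using Submodule.span_induction with
  | mem g hg => exact ⟨fun x hx => hx g hg, Or.inr fun x hx => hx g hg⟩
  | zero => simp
  | add s t _ _ h1 h2 =>
    refine ⟨fun x hx => add_nonpos (h1.1 x hx) (h2.1 x hx), ?_⟩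
    rcases h1.2 with rfl | h3
    · simpa using h2.2
    · exact Or.inr fun x hx => add_neg_of_neg_of_nonpos (h3 x hx) (h2.1 x fun g hg => (hx g hg).le)
  | smul a s _ h1 =>
    have e : ∀ x, (a • s) x = (a : ℝ) * s x := fun x => rfl
    refine ⟨fun x hx => (e x).trans_le (mul_nonpos_of_nonneg_of_nonpos a.2 (h1.1 x hx)), ?_⟩
    rcases h1.2 with rfl | h3
    · simp
    rcases a.2.eq_or_lt with h0 | h0
    · left
      ext1 x
      rw [e, ← h0]
      simp
    · exact Or.inr fun x hx => (e x).trans_lt (mul_neg_of_pos_of_neg h0 (h3 x hx))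

/-- Adding w and w' extends the two families to bases, and `h ∘ φ = -h'` is checked on a basis. The
minus sign puts the moved polytope on the far side of `h`. -/
theorem exists_linearEquiv {u u' : Fin d → Space d} (hu : AffineIndependent ℝ u)
    (hu' : AffineIndependent ℝ u') {h h' : Space d × ℝ →ₗ[ℝ] ℝ}
    (h0 : ∀ i, h (homog (u i)) = 0) (h0' : ∀ i, h' (homog (u' i)) = 0) {w w' : Space d × ℝ}
    (hw : h' w' ≠ 0) (hww : h w = -h' w') :
    ∃ φ : (Space d × ℝ) ≃ₗ[ℝ] (Space d × ℝ), (∀ i, φ (homog (u' i)) = homog (u i)) ∧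
      ∀ x, h (φ x) = -h' x := by
  have hw1 : h w ≠ 0 := by rw [hww]; exact neg_ne_zero.2 hw
  let b := basisOfLinearIndependentOfCardEqFinrank (linearIndependent_snoc_homog hu h0 hw1)
    (by rw [finrank_homog]; simp)
  let b' := basisOfLinearIndependentOfCardEqFinrank (linearIndependent_snoc_homog hu' h0' hw)
    (by rw [finrank_homog]; simp)
  let φ := b'.equiv b (Equiv.refl _)
  have hφ : ∀ j, φ ((Fin.snoc (fun i => homog (u' i)) w' : Fin (d + 1) → Space d × ℝ) j) =
      (Fin.snoc (fun i => homog (u i)) w : Fin (d + 1) → Space d × ℝ) j := fun j => by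
    have h1 : b' j = (Fin.snoc (fun i => homog (u' i)) w' : Fin (d + 1) → Space d × ℝ) j := by
      simp [b']
    have h2 : b j = (Fin.snoc (fun i => homog (u i)) w : Fin (d + 1) → Space d × ℝ) j := by
      simp [b]
    rw [← h1, ← h2]
    simp [φ]
  refine ⟨φ, fun i => by simpa using hφ i.castSucc, fun x => ?_⟩
  have : h ∘ₗ (φ : (Space d × ℝ) →ₗ[ℝ] (Space d × ℝ)) = -h' := by
    refine b'.ext fun j => ?_
    have h1 : b' j = (Fin.snoc (fun i => homog (u' i)) w' : Fin (d + 1) → Space d × ℝ) j := by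
      simp [b']
    rw [h1, LinearMap.comp_apply, LinearEquiv.coe_coe, hφ]
    refine Fin.lastCases ?_ (fun i => ?_) j
    · simpa using hww
    · simp [h0, h0']
  exact LinearMap.congr_fun this x

/-- `G` consists of the polar generators that are negative at the sum of the facet's vertices. A
generator that is zero there vanishes at every `u i`, hence is a multiple of `h`, with nonnegative
factor as seen at `a`; such generators merge into `c • h`. -/
theorem exists_facet_functionals {u : Fin d → Space d} (hu : AffineIndependent ℝ u)
    {A : Set (Space d)} (hA : A.Finite) {h : Space d × ℝ →ₗ[ℝ] ℝ} (h0 : ∀ i, h (homog (u i)) = 0)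
    {a : Space d} (ha : a ∈ A) (hneg : h (homog a) < 0) :
    ∃ G : Finset (Space d × ℝ →ₗ[ℝ] ℝ),
      (∀ g ∈ G, (∀ v ∈ range u ∪ A, g (homog v) ≤ 0) ∧ g (∑ i, homog (u i)) < 0) ∧
      ∀ L : Space d × ℝ →ₗ[ℝ] ℝ, (∀ v ∈ range u ∪ A, L (homog v) ≤ 0) →
        ∃ (c : ℝ) (s : Space d × ℝ →ₗ[ℝ] ℝ), 0 ≤ c ∧ L = c • h + s ∧
          s ∈ PointedCone.hull ℝ (G : Set (Space d × ℝ →ₗ[ℝ] ℝ)) := by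
  classical
  have hfin := ((finite_range u).union hA).image homog
  obtain ⟨G, hG⟩ := PointedCone.exists_finset_hull_polar hfin.toFinset
  simp only [Finite.mem_toFinset, forall_mem_image] at hG
  have hGV : ∀ g ∈ G, ∀ v ∈ range u ∪ A, g (homog v) ≤ 0 := fun g hg =>
    fun v hv => (hG g).1 (PointedCone.subset_hull hg) hv
  have hGu : ∀ g ∈ G, ∀ i, g (homog (u i)) ≤ 0 := fun g hg i => hGV g hg _ (Or.inl ⟨i, rfl⟩)
  refine ⟨G.filter fun g => g (∑ i, homog (u i)) < 0, ?_, fun L hL => ?_⟩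
  · intro g hg
    rw [Finset.mem_filter] at hg
    exact ⟨hGV g hg.1, hg.2⟩
  have hLG := (hG L).2 fun v hv => hL v hv
  have hle : PointedCone.hull ℝ (G : Set (Space d × ℝ →ₗ[ℝ] ℝ)) ≤ PointedCone.hull ℝ
      (insert h (G.filter fun g => g (∑ i, homog (u i)) < 0 : Finset _) : Set _) := by
    refine Submodule.span_le.2 fun g hg => ?_
    by_cases hgs : g (∑ i, homog (u i)) < 0
    · exact PointedCone.subset_hull
        (mem_insert_of_mem _ (Finset.mem_coe.2 (Finset.mem_filter.2 ⟨hg, hgs⟩)))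
    have hgu : ∀ i, g (homog (u i)) = 0 := by
      have h1 : ∑ i, g (homog (u i)) = 0 := by
        refine le_antisymm (Finset.sum_nonpos fun i _ => hGu g hg i) ?_
        rw [← map_sum]
        exact not_lt.1 hgs
      intro i
      exact (Finset.sum_eq_zero_iff_of_nonpos fun i _ => hGu g hg i).1 h1 i (Finset.mem_univ i)
    let b := basisOfLinearIndependentOfCardEqFinrank
      (linearIndependent_snoc_homog hu h0 hneg.ne) (by rw [finrank_homog]; simp)
    have hgh : g = (g (homog a) / h (homog a)) • h := by
      refine b.ext fun j => ?_
      have h1 : b j = (Fin.snoc (fun i => homog (u i)) (homog a) :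
          Fin (d + 1) → Space d × ℝ) j := by
        simp [b]
      rw [h1]
      refine Fin.lastCases ?_ (fun i => ?_) j
      · simp [hneg.ne]
      · simp [h0, hgu]
    rw [SetLike.mem_coe, hgh]
    exact PointedCone.smul_mem _
      (div_nonneg_of_nonpos (hGV g hg a (Or.inr ha)) hneg.le)
      (PointedCone.subset_hull (mem_insert _ _))
  obtain ⟨c, s, hs, hLs⟩ := Submodule.mem_span_insert.1 (hle hLG)
  exact ⟨c, s, c.2, hLs, hs⟩

theorem eventually_add_mul_neg (a : ℝ) {b : ℝ} (hb : b < 0) :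
    ∀ᶠ M : ℝ in Filter.atTop, a + M * b < 0 := by
  have : Filter.Tendsto (fun M : ℝ => a + M * b) Filter.atTop Filter.atBot :=
    Filter.tendsto_atBot_add_const_left _ _ (Filter.tendsto_id.atTop_mul_const_of_neg hb)
  exact this.eventually_lt_atBot 0

/-- A polytope with a simplex facet can be moved by a projective transformation so that it can
be glued to another polytope along a simplex facet of the latter. -/
theorem exists_gluable (hd : 0 < d) {u u' : Fin d → Space d} (hu : AffineIndependent ℝ u)
    (hu' : AffineIndependent ℝ u') {A A' : Set (Space d)} (hA : A.Finite) (hA' : A'.Finite)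
    (hAn : A.Nonempty) (hAn' : A'.Nonempty) {h h' : Space d × ℝ →ₗ[ℝ] ℝ}
    (h0 : ∀ i, h (homog (u i)) = 0) (h0' : ∀ i, h' (homog (u' i)) = 0)
    (hneg : ∀ a ∈ A, h (homog a) < 0) (hneg' : ∀ a ∈ A', h' (homog a) < 0) :
    ∃ φ : (Space d × ℝ) ≃ₗ[ℝ] (Space d × ℝ), (∀ a ∈ A', 0 < (φ (homog a)).2) ∧
      (∀ i, φ (homog (u' i)) = homog (u i)) ∧ Gluable u A (proj φ '' A') h := by
  obtain ⟨a, ha⟩ := hAn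
  obtain ⟨a', ha'⟩ := hAn'
  obtain ⟨G, hG, hGL⟩ := exists_facet_functionals hu hA h0 ha (hneg a ha)
  obtain ⟨G', hG', hGL'⟩ := exists_facet_functionals hu' hA' h0' ha' (hneg' a' ha')
  set σ := ∑ i, homog (u i) with hσ
  set σ' := ∑ i, homog (u' i) with hσ'
  -- The multiple of `homog a` is scaled so that `h` takes on it the value `-h' (homog a')`.
  obtain ⟨φ₀, hφ₀, hhφ₀⟩ := exists_linearEquiv hu hu' h0 h0' (hneg' a' ha').ne
    (w := (-h' (homog a') / h (homog a)) • homog a)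
    (by rw [map_smul, smul_eq_mul, div_mul_cancel₀ _ (hneg a ha).ne])
  have hφσ : φ₀ σ' = σ := by simp [hσ, hσ', hφ₀]
  have hhσ : h σ = 0 := by simp [hσ, h0]
  have hσ2 : σ.2 = d := by simp [hσ, Prod.snd_sum, homog]
  have hdR : (0 : ℝ) < d := by exact_mod_cast hd
  have e1 : ∀ᶠ M : ℝ in Filter.atTop, ∀ x ∈ A', 0 < (φ₀ (homog x)).2 - M * h' (homog x) * d := by
    rw [Filter.eventually_all_finite hA']
    intro x hx
    filter_upwards [eventually_add_mul_neg (-(φ₀ (homog x)).2)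
      (mul_neg_of_neg_of_pos (hneg' x hx) hdR)] with M hM
    linarith
  have e2 : ∀ᶠ M : ℝ in Filter.atTop, ∀ x ∈ A', ∀ g ∈ G,
      g (φ₀ (homog x)) - M * h' (homog x) * g σ < 0 := by
    rw [Filter.eventually_all_finite hA']
    intro x hx
    rw [Filter.eventually_all_finset]
    intro g hg
    filter_upwards [eventually_add_mul_neg (g (φ₀ (homog x)))
      (neg_neg_of_pos (mul_pos_of_neg_of_neg (hneg' x hx) (hG g hg).2))] with M hM
    linarith
  have e3 : ∀ᶠ M : ℝ in Filter.atTop, ∀ x ∈ A, ∀ g ∈ G',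
      g (φ₀.symm (homog x)) - M * h (homog x) * g σ' < 0 := by
    rw [Filter.eventually_all_finite hA]
    intro x hx
    rw [Filter.eventually_all_finset]
    intro g hg
    filter_upwards [eventually_add_mul_neg (g (φ₀.symm (homog x)))
      (neg_neg_of_pos (mul_pos_of_neg_of_neg (hneg x hx) (hG' g hg).2))] with M hM
    linarith
  obtain ⟨M, hM1, hM2, hM3⟩ := (e1.and (e2.and e3)).exists
  -- A shear along σ: it fixes the hyperplane `h = 0` pointwise, which contains σ, and its inverse
  -- has parameter `-M`. For large M it adds a large positive multiple of σ to the image of each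
  -- point of `A'`; the inverse map does the same to `A` with σ'. The last coordinate of σ is `d >
  -- 0`, so positivity of the projective denominator also holds.
  let τ : ℝ → (Space d × ℝ) →ₗ[ℝ] (Space d × ℝ) := fun M => LinearMap.id + M • h.smulRight σ
  have hτ : ∀ M x, τ M x = x + (M * h x) • σ := fun M x => by simp [τ, smul_smul]
  have hττ : ∀ M x, τ M (τ (-M) x) = x := fun M x => by
    rw [hτ, hτ, map_add, map_smul, hhσ]
    module
  let ψ : (Space d × ℝ) ≃ₗ[ℝ] (Space d × ℝ) :=
    { τ M with
      invFun := τ (-M)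
      left_inv := fun x => by simpa using hττ (-M) x
      right_inv := fun x => hττ M x }
  let φ := φ₀.trans ψ
  have hφ : ∀ x, φ x = φ₀ x - (M * h' x) • σ := fun x => by
    change τ M (φ₀ x) = _
    rw [hτ, hhφ₀]
    module
  have hφs : ∀ x, φ.symm x = φ₀.symm x - (M * h x) • σ' := fun x => by
    change φ₀.symm (τ (-M) x) = _
    rw [hτ, map_add, map_smul, ← hφσ, LinearEquiv.symm_apply_apply]
    module
  have hφu : ∀ i, φ (homog (u' i)) = homog (u i) := fun i => by simp [hφ, hφ₀, h0']
  have hhφ : ∀ x, h (φ x) = -h' x := fun x => by simp [hφ, hhφ₀, hhσ]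
  have hpos : ∀ x ∈ A', 0 < (φ (homog x)).2 := fun x hx => by
    rw [hφ]
    simpa [hσ2] using hM1 x hx
  have hpr : ∀ x ∈ A', ∀ g : Space d × ℝ →ₗ[ℝ] ℝ, g (homog (proj φ x)) =
      ((φ (homog x)).2)⁻¹ * g (φ (homog x)) := fun x hx g => by
    rw [homog_proj (hpos x hx).ne', map_smul, smul_eq_mul]
  refine ⟨φ, hpos, hφu, ?_⟩
  refine
    { finite_left := hA
      finite_right := hA'.image _
      nonempty_left := ⟨a, ha⟩
      nonempty_right := ⟨_, a', ha', rfl⟩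
      pos := hd
      indep := hu
      eq_zero := h0
      neg_left := hneg
      pos_right := ?_
      beneath_left := ?_
      beneath_right := ?_ }
  · rintro _ ⟨x, hx, rfl⟩
    rw [hpr x hx, hhφ]
    exact mul_pos (inv_pos.2 (hpos x hx)) (by linarith [hneg' x hx])
  · intro L hL
    obtain ⟨c, s, hc, hLs, hs⟩ := hGL L hL
    -- A nonnegative combination of the functionals in `G` is either zero or strictly negative
    -- wherever all of them are; this supplies the dichotomy in `Beneath`.
    obtain ⟨h1, h2⟩ := mem_hull_neg hs
    refine ⟨c, s, hc, hLs, fun v hv => h1 _ fun g hg => (hG g hg).1 v hv, ?_⟩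
    rcases h2 with h2 | h2
    · exact Or.inl h2
    refine Or.inr ⟨?_, h2 _ fun g hg => (hG g hg).2⟩
    rintro _ ⟨x, hx, rfl⟩
    rw [hpr x hx]
    refine mul_neg_of_pos_of_neg (inv_pos.2 (hpos x hx)) (h2 _ fun g hg => ?_)
    rw [hφ]
    simpa using hM2 x hx g hg
  · intro L hL
    obtain ⟨c, s, hc, hLs, hs⟩ := hGL' (L ∘ₗ (φ : (Space d × ℝ) →ₗ[ℝ] (Space d × ℝ))) (by
      rintro _ (⟨i, rfl⟩ | hx)
      · simpa [hφu] using hL _ (Or.inl ⟨i, rfl⟩)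
      · rename_i x
        have := hL (proj φ x) (Or.inr ⟨x, hx, rfl⟩)
        rw [hpr x hx] at this
        exact nonpos_of_mul_nonpos_right this (inv_pos.2 (hpos x hx)))
    obtain ⟨h1, h2⟩ := mem_hull_neg hs
    refine ⟨c, s ∘ₗ (φ.symm : (Space d × ℝ) →ₗ[ℝ] (Space d × ℝ)), hc, ?_, ?_, ?_⟩
    · refine LinearMap.ext fun x => ?_
      have h3 := LinearMap.congr_fun hLs (φ.symm x)
      have h4 := hhφ (φ.symm x)
      simp only [LinearMap.comp_apply, LinearEquiv.coe_coe, LinearEquiv.apply_symm_apply,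
        LinearMap.add_apply, LinearMap.smul_apply, LinearMap.neg_apply] at h3 h4 ⊢
      rw [h3, h4, neg_neg]
    · rintro _ (⟨i, rfl⟩ | ⟨x, hx, rfl⟩)
      · rw [← hφu, LinearMap.comp_apply, LinearEquiv.coe_coe, LinearEquiv.symm_apply_apply]
        exact h1 _ fun g hg => (hG' g hg).1 _ (Or.inl ⟨i, rfl⟩)
      · rw [LinearMap.comp_apply, LinearEquiv.coe_coe, symm_homog_proj (hpos x hx).ne', map_smul]
        exact mul_nonpos_of_nonneg_of_nonpos (inv_pos.2 (hpos x hx)).le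
          (h1 _ fun g hg => (hG' g hg).1 _ (Or.inr hx))
    · rcases h2 with rfl | h2
      · exact Or.inl (by simp)
      refine Or.inr ⟨fun x hx => h2 _ fun g hg => ?_, ?_⟩
      · rw [LinearEquiv.coe_coe, hφs]
        simpa using hM3 x hx g hg
      · have : φ.symm σ = σ' := by
          rw [LinearEquiv.symm_apply_eq]
          simp [hσ, hσ', hφu]
        rw [LinearMap.comp_apply, LinearEquiv.coe_coe, this]
        exact h2 _ fun g hg => (hG' g hg).2

/-! ### Vertices and faces under projective maps and gluing -/

/-- The convex hull of a finite set. -/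
def IsFiniteHull (P : Set (Space d)) : Prop := ∃ V : Set (Space d), V.Finite ∧ P = convexHull ℝ V

/-- All nonempty proper faces are simplices. -/
def HasSimplexFaces (P : Set (Space d)) : Prop :=
  ∀ K, IsProperFace P K → K.Nonempty → ∃ j, IsSimplex j K

theorem isFace_setOf {P : Set (Space d)} {L : Space d × ℝ →ₗ[ℝ] ℝ}
    (hL : ∀ x ∈ P, L (homog x) ≤ 0) {K : Set (Space d)} (hK : K = {x ∈ P | L (homog x) = 0}) :
    IsFace P K := by
  rcases K.eq_empty_or_nonempty with h | h
  · rw [h]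
    exact isExposed_empty
  · exact (isFace_iff h).2 ⟨L, hL, hK⟩

/-- The functional exposing v vanishes at a convex combination of points of s where it is
nonpositive, so it vanishes at a point of s, and that point is v. This later identifies which
vertices lie on a given facet. -/
theorem mem_of_mem_vertices {P s : Set (Space d)} (hs : s ⊆ P) {v : Space d}
    (hv : v ∈ vertices P) (hvs : v ∈ convexHull ℝ s) : v ∈ s := by
  obtain ⟨L, hL, hLe⟩ := (isFace_iff (singleton_nonempty v)).1 hv
  have hv0 : v ∈ {x ∈ P | L (homog x) = 0} := hLe ▸ mem_singleton v
  have h1 := mem_convexHull_of_eq_zero (fun x hx => hL x (hs hx)) hvs hv0.2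
  obtain ⟨x, hx, hx0⟩ := (convexHull_nonempty_iff (𝕜 := ℝ)).1 ⟨v, h1⟩
  have hxv : x ∈ ({v} : Set (Space d)) := hLe ▸ ⟨hs hx, hx0⟩
  exact (mem_singleton_iff.1 hxv) ▸ hx

theorem vertices_subset (P : Set (Space d)) : vertices P ⊆ P := fun v hv =>
  IsExposed.subset (show IsExposed ℝ P {v} from hv) (mem_singleton v)

theorem vertices_convexHull_subset (s : Set (Space d)) : vertices (convexHull ℝ s) ⊆ s :=
  fun _ hv => mem_of_mem_vertices (subset_convexHull ℝ s) hv (vertices_subset _ hv)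

section Projective

variable {φ : (Space d × ℝ) ≃ₗ[ℝ] (Space d × ℝ)} {P : Set (Space d)}

theorem proj_injOn (hφ : ∀ x ∈ P, 0 < (φ (homog x)).2) : InjOn (proj φ) P := fun x hx y hy h => by
  rw [← proj_symm_proj (hφ x hx).ne', h, proj_symm_proj (hφ y hy).ne']

theorem isFace_proj (hφ : ∀ x ∈ P, 0 < (φ (homog x)).2) {K : Set (Space d)} (hK : IsFace P K) :
    IsFace (proj φ '' P) (proj φ '' K) := by
  rcases K.eq_empty_or_nonempty with rfl | hKn
  · rw [image_empty]
    exact isExposed_empty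
  obtain ⟨L, hL, rfl⟩ := (isFace_iff hKn).1 hK
  have hval : ∀ x ∈ P, L (φ.symm (homog (proj φ x))) = ((φ (homog x)).2)⁻¹ * L (homog x) :=
    fun x hx => by rw [symm_homog_proj (hφ x hx).ne', map_smul, smul_eq_mul]
  refine isFace_setOf (L := L ∘ₗ (φ.symm : (Space d × ℝ) →ₗ[ℝ] (Space d × ℝ))) ?_ ?_
  · rintro _ ⟨x, hx, rfl⟩
    rw [LinearMap.comp_apply, LinearEquiv.coe_coe, hval x hx]
    exact mul_nonpos_of_nonneg_of_nonpos (inv_pos.2 (hφ x hx)).le (hL x hx)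
  · ext y
    constructor
    · rintro ⟨x, ⟨hx, hx0⟩, rfl⟩
      refine ⟨⟨x, hx, rfl⟩, ?_⟩
      rw [LinearMap.comp_apply, LinearEquiv.coe_coe, hval x hx, hx0, mul_zero]
    · rintro ⟨⟨x, hx, rfl⟩, h0⟩
      rw [LinearMap.comp_apply, LinearEquiv.coe_coe, hval x hx] at h0
      exact ⟨x, ⟨hx, (mul_eq_zero.1 h0).resolve_left (inv_pos.2 (hφ x hx)).ne'⟩, rfl⟩

theorem exists_of_isFace_proj (hφ : ∀ x ∈ P, 0 < (φ (homog x)).2) {K : Set (Space d)}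
    (hK : IsFace (proj φ '' P) K) : ∃ K₀, IsFace P K₀ ∧ K = proj φ '' K₀ := by
  rcases K.eq_empty_or_nonempty with rfl | hKn
  · exact ⟨∅, isExposed_empty, (image_empty _).symm⟩
  obtain ⟨L, hL, rfl⟩ := (isFace_iff hKn).1 hK
  have hval : ∀ x ∈ P, L (homog (proj φ x)) = ((φ (homog x)).2)⁻¹ * L (φ (homog x)) :=
    fun x hx => by rw [homog_proj (hφ x hx).ne', map_smul, smul_eq_mul]
  refine ⟨{x ∈ P | L (φ (homog x)) = 0},
    isFace_setOf (L := L ∘ₗ (φ : (Space d × ℝ) →ₗ[ℝ] (Space d × ℝ))) ?_ rfl, ?_⟩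
  · intro x hx
    have := hL _ ⟨x, hx, rfl⟩
    rw [hval x hx] at this
    exact nonpos_of_mul_nonpos_right this (inv_pos.2 (hφ x hx))
  · ext y
    constructor
    · rintro ⟨⟨x, hx, rfl⟩, h0⟩
      rw [hval x hx] at h0
      exact ⟨x, ⟨hx, (mul_eq_zero.1 h0).resolve_left (inv_pos.2 (hφ x hx)).ne'⟩, rfl⟩
    · rintro ⟨x, ⟨hx, hx0⟩, rfl⟩
      refine ⟨⟨x, hx, rfl⟩, ?_⟩
      rw [hval x hx, hx0, mul_zero]

theorem vertices_proj (hφ : ∀ x ∈ P, 0 < (φ (homog x)).2) :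
    vertices (proj φ '' P) = proj φ '' vertices P := by
  ext y
  constructor
  · intro hy
    obtain ⟨K, hK, hKe⟩ := exists_of_isFace_proj hφ hy
    have hyK : y ∈ proj φ '' K := hKe ▸ mem_singleton y
    obtain ⟨x, hx, rfl⟩ := hyK
    refine ⟨x, ?_, rfl⟩
    have hKx : K = {x} := by
      refine Subset.antisymm (fun z hz => ?_) (by simpa using hx)
      have h1 : proj φ z ∈ ({proj φ x} : Set (Space d)) := hKe ▸ mem_image_of_mem _ hz
      exact proj_injOn hφ (IsExposed.subset hK hz) (IsExposed.subset hK hx) h1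
    rwa [hKx] at hK
  · rintro ⟨x, hx, rfl⟩
    have := isFace_proj hφ hx
    rwa [image_singleton] at this

theorem affineIndependent_proj {ι : Type*} {p : ι → Space d} (hp : AffineIndependent ℝ p)
    (hφ : ∀ i, 0 < (φ (homog (p i))).2) : AffineIndependent ℝ fun i => proj φ (p i) := by
  rw [affineIndependent_iff_homog] at hp ⊢
  have h1 : LinearIndependent ℝ fun i => φ (homog (p i)) :=
    hp.map' (φ : (Space d × ℝ) →ₗ[ℝ] (Space d × ℝ)) φ.ker
  have h2 := h1.units_smul fun i => (Units.mk0 _ (hφ i).ne')⁻¹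
  convert h2 using 1
  ext i : 1
  rw [homog_proj (hφ i).ne']
  rfl

theorem isSimplex_proj {j : ℕ} (hP : IsSimplex j P) (hφ : ∀ x ∈ P, 0 < (φ (homog x)).2) :
    IsSimplex j (proj φ '' P) := by
  obtain ⟨p, hp, rfl⟩ := hP
  have h1 : ∀ i, 0 < (φ (homog (p i))).2 := fun i => hφ _ (subset_convexHull ℝ _ ⟨i, rfl⟩)
  refine ⟨_, affineIndependent_proj hp h1, ?_⟩
  rw [proj_image_convexHull (by rintro _ ⟨i, rfl⟩; exact h1 i), ← range_comp]
  rfl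

theorem hasSimplexFaces_proj (hP : HasSimplexFaces P) (hφ : ∀ x ∈ P, 0 < (φ (homog x)).2) :
    HasSimplexFaces (proj φ '' P) := by
  rintro K ⟨hK, hKP⟩ hKn
  obtain ⟨K₀, hK₀, rfl⟩ := exists_of_isFace_proj hφ hK
  obtain ⟨j, hj⟩ := hP K₀ ⟨hK₀, fun h => hKP (by rw [h])⟩ (image_nonempty.1 hKn)
  exact ⟨j, isSimplex_proj hj fun x hx => hφ x (IsExposed.subset hK₀ hx)⟩

end Projective

/-- Points of the spanning set on the supporting hyperplane lie in the simplex and can be replaced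
by its vertices; the others form `A`, nonempty since the face is proper. -/
theorem exists_decomposition {P : Set (Space d)} (hP : IsFiniteHull P) {u : Fin d → Space d}
    (hd : 0 < d) (hF : IsProperFace P (convexHull ℝ (range u))) :
    ∃ (A : Set (Space d)) (h : Space d × ℝ →ₗ[ℝ] ℝ), A.Finite ∧ A.Nonempty ∧
      (∀ i, h (homog (u i)) = 0) ∧ (∀ a ∈ A, h (homog a) < 0) ∧
      P = convexHull ℝ (range u ∪ A) := by
  obtain ⟨V, hV, rfl⟩ := hP
  have hne : (convexHull ℝ (range u)).Nonempty :=
    Nonempty.convexHull ⟨u ⟨0, hd⟩, mem_range_self _⟩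
  obtain ⟨L, hL, hLe⟩ := (isFace_iff hne).1 hF.1
  have hLV : ∀ v ∈ V, L (homog v) ≤ 0 := fun v hv => hL v (subset_convexHull ℝ V hv)
  have hu : ∀ i, u i ∈ {x ∈ convexHull ℝ V | L (homog x) = 0} := fun i =>
    hLe ▸ subset_convexHull ℝ _ ⟨i, rfl⟩
  have hVe : convexHull ℝ V = convexHull ℝ (range u ∪ {v ∈ V | L (homog v) < 0}) := by
    apply Subset.antisymm
    · refine convexHull_min (fun v hv => ?_) (convex_convexHull ℝ _)
      rcases (hLV v hv).lt_or_eq with h | h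
      · exact subset_convexHull ℝ _ (Or.inr ⟨hv, h⟩)
      · refine convexHull_mono subset_union_left ?_
        rw [hLe]
        exact ⟨subset_convexHull ℝ V hv, h⟩
    · refine convexHull_min ?_ (convex_convexHull ℝ _)
      rintro _ (⟨i, rfl⟩ | ⟨hv, _⟩)
      · exact (hu i).1
      · exact subset_convexHull ℝ V hv
  refine ⟨{v ∈ V | L (homog v) < 0}, L, hV.subset fun v hv => hv.1, ?_, fun i => (hu i).2,
    fun a ha => ha.2, hVe⟩
  by_contra hn
  rw [not_nonempty_iff_eq_empty] at hn
  rw [hn, union_empty] at hVe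
  exact hF.2 hVe.symm

/-- `Q` is the union of `P` and `P₁`, glued along the common facet `F`. -/
structure IsGlued (F P P₁ Q : Set (Space d)) : Prop where
  isFacet_left : IsFacet P F
  isFacet_right : IsFacet P₁ F
  inter_eq : P ∩ P₁ = F
  eq_union : Q = P ∪ P₁
  convex : Convex ℝ Q
  isProperFace_iff : ∀ K, IsProperFace Q K ↔ (IsProperFace P K ∨ IsProperFace P₁ K) ∧ K ≠ F
  isFiniteHull : IsFiniteHull Q
  dim_left : dim P = d
  dim_right : dim P₁ = d
  dim_union : dim Q = d

theorem IsGlued.isConnectedSum {F P P₁ P' Q : Set (Space d)} (H : IsGlued F P P₁ Q)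
    (h : IsProjectiveImage P' P₁) : IsConnectedSum F P P' Q :=
  ⟨P₁, h, H.isFacet_left, H.isFacet_right, H.inter_eq, H.eq_union, H.convex, H.isProperFace_iff⟩

/-- Existence of connected sums along simplex facets, with an arbitrary prescribed matching `u' i ↦
u i` of the vertices. -/
theorem exists_isGlued (hd : 0 < d) {P P' : Set (Space d)} (hP : IsFiniteHull P)
    (hP' : IsFiniteHull P') {u u' : Fin d → Space d} (hu : AffineIndependent ℝ u)
    (hu' : AffineIndependent ℝ u') (hF : IsProperFace P (convexHull ℝ (range u)))
    (hF' : IsProperFace P' (convexHull ℝ (range u'))) :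
    ∃ φ : (Space d × ℝ) ≃ₗ[ℝ] (Space d × ℝ), (∀ x ∈ P', 0 < (φ (homog x)).2) ∧
      (∀ i, proj φ (u' i) = u i) ∧
      IsGlued (convexHull ℝ (range u)) P (proj φ '' P') (P ∪ proj φ '' P') := by
  obtain ⟨A, h, hA, hAn, h0, hneg, rfl⟩ := exists_decomposition hP hd hF
  obtain ⟨A', h', hA', hAn', h0', hneg', rfl⟩ := exists_decomposition hP' hd hF'
  obtain ⟨φ, hφ, hφu, H⟩ := exists_gluable hd hu hu' hA hA' hAn hAn' h0 h0' hneg hneg'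
  have hpu : ∀ i, proj φ (u' i) = u i := fun i => by
    have h1 := hφu i
    rw [proj, ← homog, h1]
    simp [homog]
  have hpos : ∀ v ∈ range u' ∪ A', 0 < (φ (homog v)).2 := by
    rintro _ (⟨i, rfl⟩ | hv)
    · rw [hφu]
      simp [homog]
    · exact hφ _ hv
  have himg : proj φ '' (range u' ∪ A') = range u ∪ proj φ '' A' := by
    rw [image_union, ← range_comp]
    congr 2
    exact funext hpu
  have e : proj φ '' convexHull ℝ (range u' ∪ A') = convexHull ℝ (range u ∪ proj φ '' A') := by
    rw [proj_image_convexHull hpos, himg]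
  refine ⟨φ, fun x hx => pos_of_mem_convexHull hpos hx, hpu, ?_⟩
  rw [e]
  exact
    { isFacet_left := H.isFacet_left
      isFacet_right := H.symm.isFacet_left
      inter_eq := H.inter_eq
      eq_union := rfl
      convex := H.union_eq ▸ convex_convexHull ℝ _
      isProperFace_iff := H.isProperFace_iff
      isFiniteHull := ⟨_, ((finite_range u).union hA).union H.finite_right, H.union_eq⟩
      dim_left := H.dim_left
      dim_right := H.symm.dim_left
      dim_union := by
        rw [H.union_eq]
        obtain ⟨a, ha⟩ := hAn
        refine dim_eq_of_subset (affineIndependent_snoc hu h0 (hneg a ha).ne) ?_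
        rintro _ ⟨i, rfl⟩
        apply subset_convexHull
        refine Fin.lastCases ?_ (fun i => ?_) i
        · simpa using Or.inl (Or.inr ha)
        · simp }

namespace IsGlued

variable {F P P₁ Q : Set (Space d)}

/-- A set of smaller dimension than F is none of `P`, `P₁`, `Q`, F, so the clauses about properness
and about F drop out. Used for vertices and for edges, the latter requiring `1 < dim F`. -/
theorem isFace_iff_of_dim_lt (H : IsGlued F P P₁ Q) {K : Set (Space d)} (hK : dim K < dim F) :
    IsFace Q K ↔ IsFace P K ∨ IsFace P₁ K := by
  have h1 := H.isFacet_left.2.2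
  have h2 := H.dim_left
  have hP : K ≠ P := fun h => by subst h; omega
  have hP₁ : K ≠ P₁ := fun h => by subst h; have := H.dim_right; omega
  have hQ : K ≠ Q := fun h => by subst h; have := H.dim_union; omega
  have hF : K ≠ F := fun h => by subst h; omega
  have := H.isProperFace_iff K
  simpa [IsProperFace, hP, hP₁, hQ, hF] using this

theorem vertices_eq (H : IsGlued F P P₁ Q) (hF : 0 < dim F) :
    vertices Q = vertices P ∪ vertices P₁ := by
  ext v
  refine H.isFace_iff_of_dim_lt (K := {v}) ?_
  rw [dim, vectorSpan_singleton]
  simpa using hF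

theorem isFace_segment_iff (H : IsGlued F P P₁ Q) (hF : 1 < dim F) {a b : Space d} :
    IsFace Q (segment ℝ a b) ↔ IsFace P (segment ℝ a b) ∨ IsFace P₁ (segment ℝ a b) := by
  refine H.isFace_iff_of_dim_lt ?_
  rw [← convexHull_pair, dim_convexHull]
  exact (collinear_pair ℝ a b).finrank_le_one.trans_lt hF

theorem hasSimplexFaces (H : IsGlued F P P₁ Q) (hP : HasSimplexFaces P)
    (hP₁ : HasSimplexFaces P₁) : HasSimplexFaces Q := by
  intro K hK hKn
  rcases ((H.isProperFace_iff K).1 hK).1 with h | h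
  · exact hP K h hKn
  · exact hP₁ K h hKn

end IsGlued

theorem isSimplicial_of_hasSimplexFaces {P : Set (Space d)} (hP : IsFiniteHull P)
    (hPn : P.Nonempty) (hdim : dim P = d) (h : HasSimplexFaces P) : IsSimplicial d P := by
  obtain ⟨V, hV, rfl⟩ := hP
  refine ⟨⟨⟨hV.toFinset, ?_, by simp⟩, hdim⟩, fun F hF => h F ⟨hF.1, ?_⟩ hF.2.1⟩
  · simpa using (convexHull_nonempty_iff (𝕜 := ℝ)).1 hPn
  · intro e
    have := hF.2.2
    rw [e] at this
    omega

theorem isSimplex_of_affineIndependent {s : Set (Space d)} (hs : s.Finite) (hsn : s.Nonempty)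
    (h : AffineIndependent ℝ ((↑) : s → Space d)) : ∃ j, IsSimplex j (convexHull ℝ s) := by
  have : Fintype s := hs.fintype
  have : Nonempty s := hsn.to_subtype
  obtain ⟨j, hj⟩ : ∃ j, Fintype.card s = j + 1 :=
    ⟨Fintype.card s - 1, (Nat.sub_add_cancel Fintype.card_pos).symm⟩
  let e : Fin (j + 1) ≃ s := (Fintype.equivFinOfCardEq hj).symm
  refine ⟨j, fun i => e i, h.comp_embedding e.toEmbedding, ?_⟩
  congr 1
  ext x
  constructor
  · intro hx
    exact ⟨e.symm ⟨x, hx⟩, by simp⟩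
  · rintro ⟨i, rfl⟩
    exact (e i).2

/-! ### Faces of simplices -/

theorem exists_functional_of_simplex {p : Fin (d + 1) → Space d} (hp : AffineIndependent ℝ p)
    (f : Fin (d + 1) → ℝ) : ∃ L : Space d × ℝ →ₗ[ℝ] ℝ, ∀ i, L (homog (p i)) = f i := by
  let b := basisOfLinearIndependentOfCardEqFinrank (affineIndependent_iff_homog.1 hp)
    (by rw [finrank_homog]; simp)
  refine ⟨b.constr ℝ f, fun i => ?_⟩
  have : b i = homog (p i) := by simp [b]
  rw [← this, Module.Basis.constr_basis]

/-- The homogenized vertices form a basis, so some functional is 0 on the chosen vertices and -1 on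
the rest. -/
theorem isFace_simplex {p : Fin (d + 1) → Space d} (hp : AffineIndependent ℝ p)
    (I : Set (Fin (d + 1))) : IsFace (convexHull ℝ (range p)) (convexHull ℝ (p '' I)) := by
  classical
  obtain ⟨L, hL⟩ := exists_functional_of_simplex hp fun i => if i ∈ I then 0 else -1
  have hLV : ∀ v ∈ range p, L (homog v) ≤ 0 := by
    rintro _ ⟨i, rfl⟩
    rw [hL]
    split_ifs <;> norm_num
  refine isFace_setOf (fun x hx => nonpos_of_mem_convexHull hLV hx) ?_
  rw [setOf_eq_zero_convexHull hLV]
  congr 1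
  ext x
  constructor
  · rintro ⟨i, hi, rfl⟩
    exact ⟨⟨i, rfl⟩, by simp [hL, hi]⟩
  · rintro ⟨⟨i, rfl⟩, h0⟩
    rw [hL] at h0
    by_cases hi : i ∈ I
    · exact ⟨i, hi, rfl⟩
    · simp [hi] at h0

theorem mem_vertices_simplex {p : Fin (d + 1) → Space d} (hp : AffineIndependent ℝ p)
    (i : Fin (d + 1)) : p i ∈ vertices (convexHull ℝ (range p)) := by
  have := isFace_simplex hp {i}
  rwa [image_singleton, convexHull_singleton] at this

theorem vertices_simplex {p : Fin (d + 1) → Space d} (hp : AffineIndependent ℝ p) :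
    vertices (convexHull ℝ (range p)) = range p :=
  Subset.antisymm (vertices_convexHull_subset _)
    (by rintro _ ⟨i, rfl⟩; exact mem_vertices_simplex hp i)

theorem notMem_convexHull_simplex {p : Fin (d + 1) → Space d} (hp : AffineIndependent ℝ p)
    {I : Set (Fin (d + 1))} {i : Fin (d + 1)} (hi : i ∉ I) : p i ∉ convexHull ℝ (p '' I) := by
  intro h
  obtain ⟨j, hj, hji⟩ := mem_of_mem_vertices
    ((image_subset_range _ _).trans (subset_convexHull ℝ _)) (mem_vertices_simplex hp i) h
  exact hi (hp.injective hji ▸ hj)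

theorem isProperFace_simplex {p : Fin (d + 1) → Space d} (hp : AffineIndependent ℝ p)
    {I : Set (Fin (d + 1))} {i : Fin (d + 1)} (hi : i ∉ I) :
    IsProperFace (convexHull ℝ (range p)) (convexHull ℝ (p '' I)) :=
  ⟨isFace_simplex hp I, fun h =>
    notMem_convexHull_simplex hp hi (h ▸ subset_convexHull ℝ _ ⟨i, rfl⟩)⟩

theorem isFace_segment_simplex {p : Fin (d + 1) → Space d} (hp : AffineIndependent ℝ p)
    (i j : Fin (d + 1)) : IsFace (convexHull ℝ (range p)) (segment ℝ (p i) (p j)) := by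
  have := isFace_simplex hp {i, j}
  rwa [image_pair, convexHull_pair] at this

theorem hasSimplexFaces_simplex {p : Fin (d + 1) → Space d} (hp : AffineIndependent ℝ p) :
    HasSimplexFaces (convexHull ℝ (range p)) := by
  rintro K ⟨hK, -⟩ hKn
  obtain ⟨L, hL, hLe⟩ := (isFace_iff hKn).1 hK
  rw [setOf_eq_zero_convexHull fun v hv => hL v (subset_convexHull ℝ _ hv)] at hLe
  rw [hLe] at hKn ⊢
  refine isSimplex_of_affineIndependent ((finite_range p).subset fun v hv => hv.1)
    ((convexHull_nonempty_iff (𝕜 := ℝ)).1 hKn) ?_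
  exact (hp.range).mono fun v hv => hv.1

/-! ### The moment curve and cyclic polytopes -/

/-- The functional whose restriction to the moment curve is the polynomial `p`. -/
def polyFunctional (d : ℕ) (p : Polynomial ℝ) : Space d × ℝ →ₗ[ℝ] ℝ :=
  (∑ i : Fin d, p.coeff (i + 1) • (EuclideanSpace.proj i : Space d →L[ℝ] ℝ).toLinearMap) ∘ₗ
    LinearMap.fst ℝ _ _ + p.coeff 0 • LinearMap.snd ℝ _ _

theorem polyFunctional_momentCurve {p : Polynomial ℝ} (hp : p.natDegree ≤ d) (t : ℝ) :
    polyFunctional d p (homog (momentCurve d t)) = p.eval t := by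
  rw [Polynomial.eval_eq_sum_range' (Nat.lt_succ_of_le hp), Finset.sum_range_succ',
    Finset.sum_range]
  simp [polyFunctional, homog, momentCurve]

theorem exists_polynomial (L : Space d × ℝ →ₗ[ℝ] ℝ) :
    ∃ p : Polynomial ℝ, p.natDegree ≤ d ∧
      ∀ t, L (homog (momentCurve d t)) = p.eval t := by
  refine ⟨∑ i : Fin d, Polynomial.C (L (EuclideanSpace.single i 1, 0)) * Polynomial.X ^ (i.val + 1)
    + Polynomial.C (L (0, 1)), ?_, fun t => ?_⟩
  · refine Polynomial.natDegree_add_le_of_degree_le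
      (Polynomial.natDegree_sum_le_of_forall_le _ _ fun i _ => ?_) (by simp)
    exact (Polynomial.natDegree_C_mul_X_pow_le _ _).trans i.2
  · have e : homog (momentCurve d t) =
        ∑ i : Fin d, t ^ (i.val + 1) • ((EuclideanSpace.single i 1, 0) : Space d × ℝ) + (0, 1) := by
      refine Prod.ext ?_ ?_
      · ext j
        simp [homog, momentCurve, Prod.fst_sum, Finset.sum_apply, Pi.single_apply]
      · simp [homog, Prod.snd_sum]
    rw [e, map_add, map_sum]
    simp only [map_smul, smul_eq_mul, Polynomial.eval_add, Polynomial.eval_finsetSum,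
      Polynomial.eval_mul, Polynomial.eval_C, Polynomial.eval_pow, Polynomial.eval_X]
    congr 1
    exact Finset.sum_congr rfl fun i _ => mul_comm _ _

theorem momentCurve_injective (hd : 0 < d) : Function.Injective (momentCurve d) := fun s t h => by
  have := congrArg (fun x : Space d => x ⟨0, hd⟩) h
  simpa [momentCurve] using this

/-- Applying to a linear relation the functional of the polynomial with roots at all nodes except `s
i` isolates the i-th coefficient. -/
theorem affineIndependent_momentCurve {ι : Type*} [Fintype ι] {s : ι → ℝ}
    (hs : Function.Injective s) (hι : Fintype.card ι ≤ d + 1) :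
    AffineIndependent ℝ fun i => momentCurve d (s i) := by
  classical
  rw [affineIndependent_iff_homog, Fintype.linearIndependent_iff]
  intro g hg i
  let p : Polynomial ℝ := ∏ j ∈ Finset.univ.erase i, (Polynomial.X - Polynomial.C (s j))
  have hp : p.natDegree ≤ d := by
    rw [Polynomial.natDegree_finsetProd_X_sub_C_eq_card,
      Finset.card_erase_of_mem (Finset.mem_univ i),
      Finset.card_univ]
    omega
  have hev : ∀ j, p.eval (s j) = ∏ k ∈ Finset.univ.erase i, (s j - s k) := fun j => by
    simp [p, Polynomial.eval_prod]
  have h1 := congrArg (polyFunctional d p) hg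
  simp only [map_sum, map_smul, polyFunctional_momentCurve hp, smul_eq_mul, map_zero, hev] at h1
  rw [Finset.sum_eq_single i] at h1
  · refine (mul_eq_zero.1 h1).resolve_right (Finset.prod_ne_zero_iff.2 fun k hk => ?_)
    exact sub_ne_zero.2 fun h => Finset.ne_of_mem_erase hk (hs h).symm
  · intro j _ hj
    rw [Finset.prod_eq_zero (Finset.mem_erase.2 ⟨hj, Finset.mem_univ j⟩) (sub_self _), mul_zero]
  · simp

theorem isFace_of_polynomial {T : Set ℝ} {p : Polynomial ℝ} (hp : p.natDegree ≤ d)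
    (h0 : ∀ t ∈ T, 0 ≤ p.eval t) :
    IsFace (convexHull ℝ (momentCurve d '' T))
      (convexHull ℝ (momentCurve d '' {t ∈ T | p.eval t = 0})) := by
  have hL : ∀ t, polyFunctional d (-p) (homog (momentCurve d t)) = - p.eval t := fun t => by
    rw [polyFunctional_momentCurve (by simpa using hp), Polynomial.eval_neg]
  have hLV : ∀ v ∈ momentCurve d '' T, polyFunctional d (-p) (homog v) ≤ 0 := by
    rintro _ ⟨t, ht, rfl⟩
    rw [hL]
    linarith [h0 t ht]
  refine isFace_setOf (fun x hx => nonpos_of_mem_convexHull hLV hx) ?_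
  rw [setOf_eq_zero_convexHull hLV]
  congr 1
  ext x
  constructor
  · rintro ⟨t, ⟨ht, ht0⟩, rfl⟩
    exact ⟨⟨t, ht, rfl⟩, by rw [hL, ht0, neg_zero]⟩
  · rintro ⟨⟨t, ht, rfl⟩, h0⟩
    rw [hL, neg_eq_zero] at h0
    exact ⟨t, ⟨ht, h0⟩, rfl⟩

/-- The square of the polynomial with root set I is nonnegative and vanishes only on I; the
cardinality condition is its degree bound. -/
theorem isFace_cyclic {T : Set ℝ} {I : Finset ℝ} (hI : (I : Set ℝ) ⊆ T) (hcard : 2 * I.card ≤ d) :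
    IsFace (convexHull ℝ (momentCurve d '' T)) (convexHull ℝ (momentCurve d '' I)) := by
  have h := isFace_of_polynomial (d := d) (T := T)
    (p := (∏ j ∈ I, (Polynomial.X - Polynomial.C j)) ^ 2) ?_ ?_
  · convert h using 4
    ext t
    simp only [Finset.mem_coe, mem_ofPred_eq, Polynomial.eval_pow, Polynomial.eval_prod,
      Polynomial.eval_sub, Polynomial.eval_X, Polynomial.eval_C, pow_eq_zero_iff two_ne_zero,
      Finset.prod_eq_zero_iff, sub_eq_zero]
    constructor
    · exact fun ht => ⟨hI ht, t, ht, rfl⟩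
    · rintro ⟨-, s, hs, rfl⟩
      exact hs
  · rw [Polynomial.natDegree_pow, Polynomial.natDegree_finsetProd_X_sub_C_eq_card]
    exact hcard
  · intro t _
    rw [Polynomial.eval_pow]
    exact sq_nonneg _

theorem vertices_cyclic (hd : 2 ≤ d) (T : Set ℝ) :
    vertices (convexHull ℝ (momentCurve d '' T)) = momentCurve d '' T := by
  refine Subset.antisymm (vertices_convexHull_subset _) ?_
  rintro _ ⟨t, ht, rfl⟩
  have := isFace_cyclic (d := d) (T := T) (I := {t}) (by simpa using ht) (by simpa using hd)
  simpa [vertices] using this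

theorem isNeighborly_cyclic (hd : 0 < d) (T : Set ℝ) :
    IsNeighborly (convexHull ℝ (momentCurve d '' T)) := by
  classical
  intro W hW hcard
  have hWT := hW.trans (vertices_convexHull_subset _)
  let I : Finset ℝ := W.preimage (momentCurve d) (momentCurve_injective hd).injOn
  have hIW : momentCurve d '' I = W := by
    rw [Finset.coe_preimage, image_preimage_eq_iff]
    exact hWT.trans (image_subset_range _ _)
  have hIT : (I : Set ℝ) ⊆ T := fun t ht => by
    obtain ⟨s, hs, hst⟩ := hWT (hIW ▸ mem_image_of_mem _ ht)
    exact momentCurve_injective hd hst ▸ hs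
  have hIc : I.card = W.card := by
    rw [← Set.ncard_coe_finset, ← Set.ncard_coe_finset, ← hIW,
      ncard_image_of_injective _ (momentCurve_injective hd)]
  have := isFace_cyclic (d := d) hIT (by omega)
  rwa [hIW] at this

/-- A proper face is cut out by a nonzero polynomial of degree at most d, so it has at most d
spanning points, and these are affinely independent. -/
theorem hasSimplexFaces_cyclic {T : Set ℝ} (hT : T.Finite) :
    HasSimplexFaces (convexHull ℝ (momentCurve d '' T)) := by
  rintro K ⟨hK, hKC⟩ hKn
  obtain ⟨L, hL, hLe⟩ := (isFace_iff hKn).1 hK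
  rw [setOf_eq_zero_convexHull fun v hv => hL v (subset_convexHull ℝ _ hv)] at hLe
  obtain ⟨p, hp, hpL⟩ := exists_polynomial L
  have hp0 : p ≠ 0 := by
    rintro rfl
    apply hKC
    rw [hLe]
    congr 1
    ext x
    constructor
    · exact fun h => h.1
    · rintro ⟨t, ht, rfl⟩
      exact ⟨⟨t, ht, rfl⟩, by simp [hpL]⟩
  have hset : {v ∈ momentCurve d '' T | L (homog v) = 0} =
      range fun t : {t ∈ T | p.eval t = 0} => momentCurve d t := by
    ext x
    constructor
    · rintro ⟨⟨t, ht, rfl⟩, h0⟩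
      exact ⟨⟨t, ht, by rwa [hpL] at h0⟩, rfl⟩
    · rintro ⟨⟨t, ht, h0⟩, rfl⟩
      exact ⟨⟨t, ht, rfl⟩, by rw [hpL]; exact h0⟩
  have hfin : {t ∈ T | p.eval t = 0}.Finite := hT.subset fun t ht => ht.1
  have : Fintype {t ∈ T | p.eval t = 0} := hfin.fintype
  have hcard : Fintype.card {t ∈ T | p.eval t = 0} ≤ d := by
    rw [← Nat.card_eq_fintype_card, Nat.card_coe_set_eq]
    calc _ ≤ (p.roots.toFinset : Set ℝ).ncard := ncard_le_ncard (fun t ht => by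
              simpa [hp0] using ht.2) (Finset.finite_toSet _)
      _ ≤ p.natDegree := by
        rw [ncard_coe_finset]
        exact (Multiset.toFinset_card_le _).trans (Polynomial.card_roots' p)
      _ ≤ d := hp
  rw [hLe] at hKn ⊢
  rw [hset] at hKn ⊢
  refine isSimplex_of_affineIndependent (finite_range _)
    ((convexHull_nonempty_iff (𝕜 := ℝ)).1 hKn) ?_
  exact (affineIndependent_momentCurve (d := d) (s := fun t : {t ∈ T | p.eval t = 0} => (t : ℝ))
    Subtype.val_injective (by omega)).range

/-- The parameters `0, 1, …, N - 1`. -/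
def naturals (N : ℕ) : Set ℝ := range fun i : Fin N => (i.val : ℝ)

/-- The polynomial with roots 0, …, d - 1 changes sign on the line but is nonnegative at all natural
numbers. The point with parameter d lies off this face. -/
theorem isProperFace_cyclic (hd : 2 ≤ d) {N : ℕ} (hN : d + 1 ≤ N) :
    IsProperFace (convexHull ℝ (momentCurve d '' naturals N))
      (convexHull ℝ (range fun i : Fin d => momentCurve d (i.val : ℝ))) := by
  have hmem : (d : ℝ) ∈ naturals N := ⟨⟨d, hN⟩, rfl⟩
  have h := isFace_of_polynomial (d := d) (T := naturals N)
    (p := ∏ j : Fin d, (Polynomial.X - Polynomial.C (j.val : ℝ))) ?_ ?_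
  · have e : momentCurve d '' {t ∈ naturals N | (∏ j : Fin d,
        (Polynomial.X - Polynomial.C (j.val : ℝ))).eval t = 0} =
        range fun i : Fin d => momentCurve d (i.val : ℝ) := by
      ext x
      simp only [Polynomial.eval_prod, Polynomial.eval_sub, Polynomial.eval_X, Polynomial.eval_C,
        Finset.prod_eq_zero_iff, sub_eq_zero, mem_image, mem_range, mem_ofPred_eq,
        Finset.mem_univ, true_and]
      constructor
      · rintro ⟨t, ⟨-, i, rfl⟩, rfl⟩
        exact ⟨i, rfl⟩
      · rintro ⟨i, rfl⟩
        exact ⟨_, ⟨⟨⟨i, by omega⟩, rfl⟩, i, rfl⟩, rfl⟩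
    rw [e] at h
    refine ⟨h, fun he => ?_⟩
    have h1 : momentCurve d (d : ℝ) ∈ vertices (convexHull ℝ (momentCurve d '' naturals N)) := by
      rw [vertices_cyclic hd]
      exact ⟨_, hmem, rfl⟩
    have h2 := he ▸ vertices_subset _ h1
    obtain ⟨i, hi⟩ := mem_of_mem_vertices (he ▸ subset_convexHull ℝ _) h1 h2
    have h3 := momentCurve_injective (by omega) hi
    exact i.2.ne (by exact_mod_cast h3)
  · rw [Polynomial.natDegree_finsetProd_X_sub_C_eq_card]
    simp
  · rintro _ ⟨i, rfl⟩
    simp only [Polynomial.eval_prod, Polynomial.eval_sub, Polynomial.eval_X, Polynomial.eval_C]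
    rcases lt_or_ge i.val d with hi | hi
    · exact (Finset.prod_eq_zero (Finset.mem_univ (⟨i.val, hi⟩ : Fin d)) (sub_self _)).ge
    · refine Finset.prod_nonneg fun j _ => sub_nonneg.2 ?_
      exact_mod_cast j.2.le.trans hi

theorem isCyclic_naturals {N : ℕ} (hN : d + 1 ≤ N) :
    IsCyclic (convexHull ℝ (momentCurve d '' naturals N)) :=
  ⟨N, hN, fun i => (i.val : ℝ), fun i j h => Nat.cast_lt.2 h, by
    rw [naturals, ← range_comp]
    rfl⟩

theorem ncard_naturals (N : ℕ) : (naturals N).ncard = N := by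
  have hinj : Function.Injective fun i : Fin N => (i.val : ℝ) := fun i j h =>
    Fin.ext (Nat.cast_injective h)
  rw [naturals, ← image_univ, ncard_image_of_injective _ hinj, ncard_univ, Nat.card_fin]

/-! ### Stacked paths of simplices -/

theorem isProjectiveImage_proj {φ : (Space d × ℝ) ≃ₗ[ℝ] (Space d × ℝ)} {P : Set (Space d)}
    (hφ : ∀ x ∈ P, 0 < (φ (homog x)).2) : IsProjectiveImage P (proj φ '' P) :=
  ⟨φ, hφ, rfl⟩

theorem dim_facet {F P P₁ Q : Set (Space d)} (H : IsGlued F P P₁ Q) : dim F + 1 = d :=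
  H.isFacet_left.2.2.trans H.dim_left

/-- `S` is a stacked polytope whose vertices `v 0, …, v (d + k)` are listed so that `v i` and `v j`
are adjacent exactly when `|i - j| ≤ d`, with facets spanned by the first and by the last `d`. -/
structure IsStackedPath (d k : ℕ) (v : ℕ → Space d) (S : Set (Space d)) : Prop where
  isStacked : IsStacked S
  isFiniteHull : IsFiniteHull S
  hasSimplexFaces : HasSimplexFaces S
  vertices_eq : vertices S = v '' Iic (d + k)
  injOn : InjOn v (Iic (d + k))
  edge_iff : ∀ i j, i < j → j ≤ d + k → (IsFace S (segment ℝ (v i) (v j)) ↔ j ≤ i + d)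
  indep_first : AffineIndependent ℝ fun i : Fin d => v i
  first : IsProperFace S (convexHull ℝ (range fun i : Fin d => v i))
  indep_last : AffineIndependent ℝ fun i : Fin d => v (k + 1 + i)
  last : IsProperFace S (convexHull ℝ (range fun i : Fin d => v (k + 1 + i)))

namespace IsStackedPath

variable {k : ℕ} {v : ℕ → Space d} {S : Set (Space d)}

theorem mem_vertices (H : IsStackedPath d k v S) {i : ℕ} (hi : i ≤ d + k) : v i ∈ vertices S :=
  H.vertices_eq ▸ mem_image_of_mem v hi

theorem mem_range_of_mem_convexHull (H : IsStackedPath d k v S) {u : Fin d → Space d}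
    (hF : IsFace S (convexHull ℝ (range u))) {i : ℕ} (hi : i ≤ d + k)
    (h : v i ∈ convexHull ℝ (range u)) : v i ∈ range u :=
  mem_of_mem_vertices ((subset_convexHull ℝ _).trans (IsExposed.subset hF)) (H.mem_vertices hi) h

theorem lt_of_mem_first (H : IsStackedPath d k v S) {i : ℕ} (hi : i ≤ d + k)
    (h : v i ∈ convexHull ℝ (range fun i : Fin d => v i)) : i < d := by
  obtain ⟨j, hj⟩ := H.mem_range_of_mem_convexHull H.first.1 hi h
  have hjd := j.2
  have := H.injOn (show j.val ≤ d + k by omega) hi hj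
  omega

theorem lt_of_mem_last (H : IsStackedPath d k v S) {i : ℕ} (hi : i ≤ d + k)
    (h : v i ∈ convexHull ℝ (range fun i : Fin d => v (k + 1 + i))) : k < i := by
  obtain ⟨j, hj⟩ := H.mem_range_of_mem_convexHull H.last.1 hi h
  have hjd := j.2
  have := H.injOn (show k + 1 + j.val ≤ d + k by omega) hi hj
  omega

theorem zero (d : ℕ) : ∃ v S, IsStackedPath d 0 v S := by
  let p : Fin (d + 1) → Space d := fun i => momentCurve d (i.val : ℝ)
  have hp : AffineIndependent ℝ p := affineIndependent_momentCurve (s := fun i : Fin (d + 1) =>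
    (i.val : ℝ)) (fun i j h => Fin.ext (Nat.cast_injective h)) (by simp)
  let v : ℕ → Space d := fun i => momentCurve d (i : ℝ)
  have hcast : (range fun i : Fin d => v i) = p '' (range Fin.castSucc) := by
    rw [← range_comp]
    rfl
  have hsucc : (range fun i : Fin d => v (0 + 1 + i)) = p '' (range Fin.succ) := by
    rw [← range_comp]
    congr 1
    ext i : 1
    simp only [v, p, Function.comp_apply, Fin.val_succ]
    rw [zero_add, add_comm]
  have hrange : range p = v '' Iic (d + 0) := by
    ext x
    constructor
    · rintro ⟨i, rfl⟩
      exact ⟨i, Nat.lt_succ_iff.1 i.2, rfl⟩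
    · rintro ⟨i, hi, rfl⟩
      exact ⟨⟨i, Nat.lt_succ_iff.2 hi⟩, rfl⟩
  refine ⟨v, convexHull ℝ (range p), ?_⟩
  refine
    { isStacked := .simplex ⟨p, hp, rfl⟩
      isFiniteHull := ⟨_, finite_range p, rfl⟩
      hasSimplexFaces := hasSimplexFaces_simplex hp
      vertices_eq := by rw [vertices_simplex hp, hrange]
      injOn := fun i hi j hj h => ?_
      edge_iff := fun i j hij hj => ⟨fun _ => by omega, fun _ => ?_⟩
      indep_first := hp.comp_embedding Fin.castSuccEmb
      first := hcast ▸ isProperFace_simplex hp (i := Fin.last d) ?_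
      indep_last := ?_
      last := hsucc ▸ isProperFace_simplex hp (i := 0) ?_ }
  · exact congrArg Fin.val (hp.injective (a₁ := ⟨i, Nat.lt_succ_iff.2 hi⟩)
      (a₂ := ⟨j, Nat.lt_succ_iff.2 hj⟩) h)
  · exact isFace_segment_simplex hp ⟨i, by omega⟩ ⟨j, by omega⟩
  · rintro ⟨i, hi⟩
    exact (Fin.castSucc_lt_last i).ne hi
  · convert hp.comp_embedding (Fin.succEmb d) using 1
    ext i : 1
    simp only [v, p, Function.comp_apply, Fin.val_succ, Fin.coe_succEmb]
    rw [zero_add, add_comm]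
  · rintro ⟨i, hi⟩
    exact Fin.succ_ne_zero i hi

/-- A simplex is glued onto the last facet, its first d vertices matched in order with the last d of
the path. Its apex becomes vertex `d + k + 1`, adjacent exactly to those d, and dropping the
simplex's first vertex gives the new last facet. Since facets have dimension d - 1, `3 ≤ d` is what
lets edges survive the gluing. -/
theorem succ (hd : 3 ≤ d) (H : IsStackedPath d k v S) :
    ∃ v' S', IsStackedPath d (k + 1) v' S' := by
  let p : Fin (d + 1) → Space d := fun i => momentCurve d (i.val : ℝ)
  have hp : AffineIndependent ℝ p := affineIndependent_momentCurve (s := fun i : Fin (d + 1) =>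
    (i.val : ℝ)) (fun i j h => Fin.ext (Nat.cast_injective h)) (by simp)
  set F := convexHull ℝ (range fun i : Fin d => v (k + 1 + i)) with hF
  have hcast : (range fun i : Fin d => p i.castSucc) = p '' (range Fin.castSucc) := by
    rw [← range_comp]
    rfl
  have hpF : IsProperFace (convexHull ℝ (range p))
      (convexHull ℝ (range fun i : Fin d => p i.castSucc)) := by
    refine hcast ▸ isProperFace_simplex hp (i := Fin.last d) ?_
    rintro ⟨i, hi⟩
    exact (Fin.castSucc_lt_last i).ne hi
  obtain ⟨φ, hφ, hφu, hG⟩ := exists_isGlued (by omega) H.isFiniteHull ⟨_, finite_range p, rfl⟩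
    H.indep_last (hp.comp_embedding Fin.castSuccEmb) H.last hpF
  have hφp : ∀ i, 0 < (φ (homog (p i))).2 := fun i => hφ _ (subset_convexHull ℝ _ ⟨i, rfl⟩)
  let q : Fin (d + 1) → Space d := fun i => proj φ (p i)
  have hq : AffineIndependent ℝ q := affineIndependent_proj hp hφp
  have hqc : ∀ i : Fin d, q i.castSucc = v (k + 1 + i) := hφu
  have e : proj φ '' convexHull ℝ (range p) = convexHull ℝ (range q) := by
    rw [proj_image_convexHull (by rintro _ ⟨i, rfl⟩; exact hφp i), ← range_comp]
    rfl
  have hcs : IsConnectedSum F S (convexHull ℝ (range p)) (S ∪ convexHull ℝ (range q)) :=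
    e ▸ hG.isConnectedSum (isProjectiveImage_proj hφ)
  rw [e, ← hF] at hG
  have hFq : F = convexHull ℝ (q '' range Fin.castSucc) := by
    rw [hF, ← range_comp]
    congr 2
    exact funext fun i => (hqc i).symm
  let v' : ℕ → Space d := Function.update v (d + k + 1) (q (Fin.last d))
  have hv' : ∀ i, i ≤ d + k → v' i = v i := fun i hi =>
    Function.update_of_ne (by omega) _ _
  have hvl : v' (d + k + 1) = q (Fin.last d) := Function.update_self _ _ _
  have hqv : ∀ i : Fin (d + 1), q i = v' (k + 1 + i) := by
    intro i
    refine Fin.lastCases ?_ (fun i => ?_) i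
    · rw [← hvl, Fin.val_last]
      congr 1
      omega
    · rw [hqc, hv' _ (by have := i.2; simp only [Fin.val_castSucc]; omega)]
      rfl
  have hlF : q (Fin.last d) ∉ F := by
    rw [hFq]
    refine notMem_convexHull_simplex hq ?_
    rintro ⟨i, hi⟩
    exact (Fin.castSucc_lt_last i).ne hi
  have hqT : ∀ i, q i ∈ convexHull ℝ (range q) := fun i => subset_convexHull ℝ _ ⟨i, rfl⟩
  have hlS : q (Fin.last d) ∉ S := fun h => hlF (hG.inter_eq ▸ ⟨h, hqT _⟩)
  have hvS : ∀ i ≤ d + k, v i ∈ S := fun i hi => vertices_subset S (H.mem_vertices hi)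
  have hF0 : convexHull ℝ (range fun i : Fin d => v i) ≠ F := by
    intro h
    have h1 : v 0 ∈ F := h ▸ subset_convexHull ℝ _ ⟨⟨0, by omega⟩, rfl⟩
    have := H.lt_of_mem_last (Nat.zero_le _) h1
    omega
  have hdimF := dim_facet hG
  have hfirst : (fun i : Fin d => v' i) = fun i : Fin d => v i :=
    funext fun i => hv' _ (by have := i.2; omega)
  have hlast : (fun i : Fin d => v' (k + 1 + 1 + i)) = fun i : Fin d => q i.succ :=
    funext fun i => by
      rw [hqv, Fin.val_succ]
      congr 1
      omega
  have hlast' : (range fun i : Fin d => q i.succ) = q '' range Fin.succ := by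
    rw [← range_comp]
    rfl
  have hseg : ∀ {P : Set (Space d)} {a b : Space d}, IsFace P (segment ℝ a b) → a ∈ P ∧ b ∈ P :=
    fun h => ⟨IsExposed.subset h (left_mem_segment ℝ _ _),
      IsExposed.subset h (right_mem_segment ℝ _ _)⟩
  have hle : ∀ i, i ≤ d + (k + 1) → i ≤ d + k ∨ i = d + k + 1 := fun i hi => by omega
  refine ⟨v', S ∪ convexHull ℝ (range q), ?_⟩
  refine
    { isStacked := .stack H.isStacked ⟨p, hp, rfl⟩ hcs
      isFiniteHull := hG.isFiniteHull
      hasSimplexFaces := hG.hasSimplexFaces H.hasSimplexFaces (hasSimplexFaces_simplex hq)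
      vertices_eq := ?_
      injOn := ?_
      edge_iff := ?_
      indep_first := hfirst ▸ H.indep_first
      first := hfirst ▸ (hG.isProperFace_iff _).2 ⟨Or.inl H.first, hF0⟩
      indep_last := hlast ▸ hq.comp_embedding (Fin.succEmb d)
      last := ?_ }
  · rw [hG.vertices_eq (by omega), H.vertices_eq, vertices_simplex hq]
    ext x
    constructor
    · rintro (⟨i, hi, rfl⟩ | ⟨i, rfl⟩)
      · exact ⟨i, Nat.le_succ_of_le hi, hv' i hi⟩
      · exact ⟨k + 1 + i, by have := i.2; simp only [mem_Iic]; omega, (hqv i).symm⟩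
    · rintro ⟨i, hi, rfl⟩
      rcases hle _ hi with h | h
      · exact Or.inl ⟨i, h, (hv' i h).symm⟩
      · right
        exact ⟨Fin.last d, by rw [← hvl, h]⟩
  · have hcase : ∀ i ≤ d + k, v' i ≠ v' (d + k + 1) := fun i hi h => by
      rw [hv' i hi, hvl] at h
      exact hlS (h ▸ hvS i hi)
    intro i hi j hj h
    rcases hle _ hi with hi' | hi' <;> rcases hle _ hj with hj' | hj'
    · rw [hv' i hi', hv' j hj'] at h
      exact H.injOn hi' hj' h
    · exact absurd (hj' ▸ h) (hcase i hi')
    · exact absurd (hi' ▸ h).symm (hcase j hj')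
    · exact hi'.trans hj'.symm
  · intro i j hij hj
    rw [hG.isFace_segment_iff (by omega)]
    have hiS : v' i ∈ convexHull ℝ (range q) → k < i := fun h => by
      have hi : i ≤ d + k := by omega
      rw [hv' i hi] at h
      exact H.lt_of_mem_last hi (hF ▸ hG.inter_eq ▸ ⟨hvS i hi, h⟩)
    have hiq : IsFace (convexHull ℝ (range q)) (segment ℝ (v' i) (v' j)) → j ≤ i + d := fun h => by
      have := hiS (hseg h).1
      omega
    rcases hle _ hj with hj' | hj'
    · have h1 : IsFace S (segment ℝ (v' i) (v' j)) ↔ j ≤ i + d := by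
        rw [hv' i (by omega), hv' j hj']
        exact H.edge_iff i j hij hj'
      rw [h1]
      exact ⟨fun h => h.elim id hiq, Or.inl⟩
    · constructor
      · rintro (h | h)
        · have h2 := (hseg h).2
          rw [hj', hvl] at h2
          exact absurd h2 hlS
        · exact hiq h
      · intro h
        right
        have h1 := isFace_segment_simplex hq ⟨i - (k + 1), by omega⟩ ⟨j - (k + 1), by omega⟩
        rw [hqv, hqv] at h1
        simp only at h1
        rwa [Nat.add_sub_cancel' (by omega), Nat.add_sub_cancel' (by omega)] at h1
  · rw [hlast, hlast']
    refine (hG.isProperFace_iff _).2 ⟨Or.inr (isProperFace_simplex hq (i := 0) ?_), ?_⟩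
    · rintro ⟨i, hi⟩
      exact Fin.succ_ne_zero i hi
    · intro h
      refine hlF (h ▸ subset_convexHull ℝ _ ⟨Fin.last d, ⟨⟨d - 1, by omega⟩, ?_⟩, rfl⟩)
      ext
      simp
      omega

theorem exists_of_le (hd : 3 ≤ d) (k : ℕ) : ∃ v S, IsStackedPath d k v S := by
  induction k with
  | zero => exact IsStackedPath.zero d
  | succ k ih =>
    obtain ⟨v, S, H⟩ := ih
    exact H.succ hd

end IsStackedPath

end Polytope

/-! ### Edge cuts of two cliques joined by few edges -/

namespace SimpleGraph

variable {V : Type*} {G : SimpleGraph V}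

theorem crossingEdges_compl (X : Set V) : G.crossingEdges Xᶜ = G.crossingEdges X := by
  ext e
  constructor
  · rintro ⟨x, hx, y, hy, h, rfl⟩
    exact ⟨y, not_not.1 hy, x, hx, h.symm, Sym2.eq_swap⟩
  · rintro ⟨x, hx, y, hy, h, rfl⟩
    exact ⟨y, hy, x, not_not.2 hx, h.symm, Sym2.eq_swap⟩

/-- An edge cut that separates two vertices of a clique `K` has at least `|K| - 1` edges. -/
theorem encard_le_crossingEdges {K Y : Set V} (hK : G.IsClique K) {x y : V} (hx : x ∈ K)
    (hxY : x ∈ Y) (hy : y ∈ K) (hyY : y ∉ Y) : (K \ {x}).encard ≤ (G.crossingEdges Y).encard := by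
  classical
  -- Each z in K other than x names one crossing edge: to y if z is on the side of x, to x
  -- otherwise. The vertex y itself gives the edge xy.
  refine encard_le_encard_of_injOn (f := fun z => if z ∈ Y then s(z, y) else s(x, z)) ?_ ?_
  · rintro z ⟨hz, hzx⟩
    have hzx : z ≠ x := hzx
    by_cases hzY : z ∈ Y
    · simp only [hzY, if_true]
      have hzy : z ≠ y := fun h => hyY (h ▸ hzY)
      exact ⟨z, hzY, y, hyY, hK hz hy hzy, rfl⟩
    · simp only [hzY, if_false]
      exact ⟨x, hxY, z, hzY, hK hx hz hzx.symm, rfl⟩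
  · rintro z ⟨hz, hzx⟩ w ⟨hw, hwx⟩ h
    have hzx : z ≠ x := hzx
    have hwx : w ≠ x := hwx
    have hxy : x ≠ y := fun h => hyY (h ▸ hxY)
    by_cases hzY : z ∈ Y <;> by_cases hwY : w ∈ Y <;>
      simp only [hzY, hwY, if_true, if_false, Sym2.eq_iff] at h
    · rcases h with h | h
      · exact h.1
      · exact h.1.trans h.2
    · rcases h with h | h
      · exact absurd h.1 hzx
      · exact absurd h.2.symm hxy
    · rcases h with h | h
      · exact absurd h.1.symm hwx
      · exact absurd h.1 hxy
    · rcases h with h | h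
      · exact h.2
      · exact absurd h.2 hzx

theorem encard_diff_singleton_ge {K : Set V} {N : ℕ} (hK : N + 1 ≤ K.ncard) (x : V) :
    (N : ℕ∞) ≤ (K \ {x}).encard := by
  -- An infinite set has `ncard` 0, so the lower bound on `ncard` forces finiteness.
  have hfin : K.Finite := finite_of_ncard_pos (by omega)
  rw [← (hfin.sdiff).cast_ncard_eq, Nat.cast_le]
  have := le_ncard_sdiff {x} K
  rw [ncard_singleton] at this
  omega

/-- Two large cliques joined by few edges: the edges between them form a minimum edge cut. -/
theorem isMinimumEdgeCut_of_cliques {X : Set V} {N : ℕ} (hX : G.IsClique X)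
    (hXc : G.IsClique Xᶜ) (hN : N + 1 ≤ X.ncard) (hNc : N + 1 ≤ Xᶜ.ncard)
    (hD : (G.crossingEdges X).encard = N) :
    G.IsMinimumEdgeCut (G.crossingEdges X) := by
  have hXn : X.Nonempty := nonempty_of_ncard_ne_zero (by omega)
  have hXcn : Xᶜ.Nonempty := nonempty_of_ncard_ne_zero (by omega)
  refine ⟨⟨X, hXn, fun h => ?_, rfl⟩, ?_⟩
  · rw [h, compl_univ] at hXcn
    exact not_nonempty_empty hXcn
  rintro _ ⟨Y, hYn, hYu, rfl⟩
  rw [hD]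
  by_cases h1 : ∃ x ∈ X, x ∈ Y ∧ ∃ y ∈ X, y ∉ Y
  · obtain ⟨x, hx, hxY, y, hy, hyY⟩ := h1
    exact (encard_diff_singleton_ge hN x).trans (encard_le_crossingEdges hX hx hxY hy hyY)
  by_cases h2 : ∃ x ∈ Xᶜ, x ∈ Y ∧ ∃ y ∈ Xᶜ, y ∉ Y
  · obtain ⟨x, hx, hxY, y, hy, hyY⟩ := h2
    exact (encard_diff_singleton_ge hNc x).trans (encard_le_crossingEdges hXc hx hxY hy hyY)
  push Not at h1 h2
  -- A cut that splits neither clique can only separate one from the other.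
  have h3 : Y = X ∨ Y = Xᶜ := by
    obtain ⟨y, hy⟩ := hYn
    obtain ⟨z, hz⟩ := (ne_univ_iff_exists_notMem Y).1 hYu
    by_cases hyX : y ∈ X
    · left
      have hXY : X ⊆ Y := h1 y hyX hy
      refine Subset.antisymm (fun w hw => ?_) hXY
      by_contra hwX
      exact hz ((em (z ∈ X)).elim (fun h => hXY h) fun h => h2 w hwX hw z h)
    · right
      have hXY : Xᶜ ⊆ Y := h2 y hyX hy
      refine Subset.antisymm (fun w hw hwX => ?_) hXY
      exact hz ((em (z ∈ X)).elim (fun h => h1 w hwX hw z h) fun h => hXY h)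
  rcases h3 with rfl | rfl
  · exact hD.ge
  · rw [crossingEdges_compl]
    exact hD.ge

/-- A star at v would contain an edge from v to another vertex of its own clique, and that edge does
not cross. -/
theorem not_isTrivialCut_of_cliques {X : Set V} {N : ℕ} (hX : G.IsClique X)
    (hXc : G.IsClique Xᶜ) (hN : N + 1 ≤ X.ncard) (hNc : N + 1 ≤ Xᶜ.ncard)
    (h1 : 1 ≤ N) : ¬ G.IsTrivialCut (G.crossingEdges X) := by
  rintro ⟨v, hv⟩
  have key : ∀ K : Set V, G.IsClique K → N + 1 ≤ K.ncard → v ∈ K →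
      ∃ w ∈ K, s(v, w) ∈ G.crossingEdges X := by
    intro K hK hKN hvK
    obtain ⟨w, hw, hwv⟩ := exists_ne_of_one_lt_ncard (by omega : 1 < K.ncard) v
    exact ⟨w, hw, hv ▸ (G.mk'_mem_incidenceSet_left_iff.2 (hK hvK hw hwv.symm))⟩
  by_cases hvX : v ∈ X
  · obtain ⟨w, hw, a, ha, b, hb, -, hab⟩ := key X hX hN hvX
    rcases Sym2.eq_iff.1 hab with ⟨rfl, rfl⟩ | ⟨rfl, rfl⟩
    · exact hb hw
    · exact hb hvX
  · obtain ⟨w, hw, a, ha, b, hb, -, hab⟩ := key Xᶜ hXc hNc hvX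
    rcases Sym2.eq_iff.1 hab with ⟨rfl, rfl⟩ | ⟨rfl, rfl⟩
    · exact hvX ha
    · exact hw ha

theorem le_ncard_neighborSet_of_cliques [Finite V] {X : Set V} {N : ℕ} (hX : G.IsClique X)
    (hXc : G.IsClique Xᶜ) (hN : N + 1 ≤ X.ncard) (hNc : N + 1 ≤ Xᶜ.ncard)
    (v : V) : N ≤ (G.neighborSet v).ncard := by
  have key : ∀ K : Set V, G.IsClique K → N + 1 ≤ K.ncard → v ∈ K →
      N ≤ (G.neighborSet v).ncard := by
    intro K hK hKN hvK
    have h1 := encard_diff_singleton_ge hKN v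
    rw [← (toFinite (K \ {v})).cast_ncard_eq, Nat.cast_le] at h1
    refine h1.trans (ncard_le_ncard (fun w hw => ?_) (toFinite _))
    exact hK hvK hw.1 (Ne.symm hw.2)
  by_cases hvX : v ∈ X
  · exact key X hX hN hvX
  · exact key Xᶜ hXc hNc hvX

end SimpleGraph

/-! ### The dumbbell: cyclic polytopes glued to both ends of a stacked path -/

namespace Polytope

variable {d : ℕ}

theorem segment_proj {φ : (Space d × ℝ) ≃ₗ[ℝ] (Space d × ℝ)} {a b : Space d}
    (ha : 0 < (φ (homog a)).2) (hb : 0 < (φ (homog b)).2) :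
    proj φ '' segment ℝ a b = segment ℝ (proj φ a) (proj φ b) := by
  rw [← convexHull_pair, proj_image_convexHull (by simp [ha, hb]), image_pair, convexHull_pair]

/-- This is where `4 ≤ d` is needed: a pair of points requires a polynomial of degree 4. -/
theorem isFace_segment_cyclic (hd : 4 ≤ d) {T : Set ℝ} {a b : Space d}
    (ha : a ∈ momentCurve d '' T) (hb : b ∈ momentCurve d '' T) :
    IsFace (convexHull ℝ (momentCurve d '' T)) (segment ℝ a b) := by
  classical
  obtain ⟨s, hs, rfl⟩ := ha
  obtain ⟨t, ht, rfl⟩ := hb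
  have := isFace_cyclic (d := d) (T := T) (I := {s, t}) (by simp [insert_subset_iff, hs, ht])
    (by have := Finset.card_le_two (a := s) (b := t); omega)
  rwa [Finset.coe_pair, image_pair, convexHull_pair] at this

theorem isFace_segment_proj_cyclic (hd : 4 ≤ d) {T : Set ℝ}
    {φ : (Space d × ℝ) ≃ₗ[ℝ] (Space d × ℝ)}
    (hφ : ∀ x ∈ convexHull ℝ (momentCurve d '' T), 0 < (φ (homog x)).2) {a b : Space d}
    (ha : a ∈ vertices (proj φ '' convexHull ℝ (momentCurve d '' T)))
    (hb : b ∈ vertices (proj φ '' convexHull ℝ (momentCurve d '' T))) :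
    IsFace (proj φ '' convexHull ℝ (momentCurve d '' T)) (segment ℝ a b) := by
  rw [vertices_proj hφ, vertices_cyclic (by omega)] at ha hb
  obtain ⟨a, ha, rfl⟩ := ha
  obtain ⟨b, hb, rfl⟩ := hb
  rw [← segment_proj (hφ a (subset_convexHull ℝ _ ha)) (hφ b (subset_convexHull ℝ _ hb))]
  exact isFace_proj hφ (isFace_segment_cyclic hd ha hb)

theorem ncard_vertices_proj_cyclic (hd : 2 ≤ d) {N : ℕ}
    {φ : (Space d × ℝ) ≃ₗ[ℝ] (Space d × ℝ)}
    (hφ : ∀ x ∈ convexHull ℝ (momentCurve d '' naturals N), 0 < (φ (homog x)).2) :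
    (vertices (proj φ '' convexHull ℝ (momentCurve d '' naturals N))).ncard = N := by
  rw [vertices_proj hφ, vertices_cyclic hd,
    ((proj_injOn hφ).mono (subset_convexHull ℝ _)).ncard_image,
    ncard_image_of_injective _ (momentCurve_injective (by omega)), ncard_naturals]

/-- If a combination of the last vertices lay on the hyperplane supporting the first facet, one of
those vertices would lie on it too, and hence in the first facet. -/
theorem IsStackedPath.disjoint {k : ℕ} {v : ℕ → Space (k + 1)} {S : Set (Space (k + 1))}
    (H : IsStackedPath (k + 1) k v S) :
    Disjoint (convexHull ℝ (range fun i : Fin (k + 1) => v i))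
      (convexHull ℝ (range fun i : Fin (k + 1) => v (k + 1 + i))) := by
  rw [Set.disjoint_left]
  intro z hz hz'
  obtain ⟨L, hL, hLe⟩ := (isFace_iff ⟨z, hz⟩).1 H.first.1
  have hz0 : L (homog z) = 0 := (hLe ▸ hz : z ∈ {x ∈ S | L (homog x) = 0}).2
  have hv : ∀ i : Fin (k + 1), v (k + 1 + i) ∈ S := fun i =>
    vertices_subset S (H.mem_vertices (by have := i.2; omega))
  have h1 := mem_convexHull_of_eq_zero (by rintro _ ⟨i, rfl⟩; exact hL _ (hv i)) hz' hz0
  obtain ⟨_, ⟨i, rfl⟩, h0⟩ := (convexHull_nonempty_iff (𝕜 := ℝ)).1 ⟨z, h1⟩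
  have hi : v (k + 1 + i) ∈ convexHull ℝ (range fun i : Fin (k + 1) => v i) := by
    rw [hLe]
    exact ⟨hv i, h0⟩
  have := H.lt_of_mem_first (by have := i.2; omega) hi
  omega

theorem two_mul_sum_range_succ (d : ℕ) : 2 * ∑ i ∈ Finset.range d, (i + 1) = d ^ 2 + d := by
  induction d with
  | zero => simp
  | succ n ih =>
    rw [Finset.sum_range_succ, mul_add, ih]
    ring

/-- The edges of a stacked path between its first half and its second half. -/
theorem IsStackedPath.encard_middle_edges {k : ℕ} {v : ℕ → Space (k + 1)}
    {S : Set (Space (k + 1))} (H : IsStackedPath (k + 1) k v S) :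
    ((fun p : Σ _ : ℕ, ℕ => s(v p.1, v (k + 1 + p.2))) ''
      (((Finset.range (k + 1)).sigma fun i => Finset.range (i + 1) :
        Finset (Σ _ : ℕ, ℕ)) : Set (Σ _ : ℕ, ℕ))).encard =
      (((k + 1) ^ 2 + (k + 1)) / 2 : ℕ) := by
  -- The adjacency condition `k + 1 + m ≤ i + (k + 1)` reads `m ≤ i`, so `v i` accounts for i + 1
  -- edges.
  rw [InjOn.encard_image, encard_coe_eq_coe_finsetCard, Finset.card_sigma]
  · simp only [Finset.card_range]
    rw [← two_mul_sum_range_succ, Nat.mul_div_cancel_left _ two_pos]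
  · rintro ⟨i, m⟩ hp ⟨j, n⟩ hq h
    simp only [Finset.coe_sigma, Finset.coe_range, mem_sigma_iff, mem_Iio] at hp hq
    rcases Sym2.eq_iff.1 h with h | h
    · have h1 : i = j := H.injOn (show i ≤ k + 1 + k by omega) (show j ≤ k + 1 + k by omega) h.1
      have h2 := H.injOn (show k + 1 + m ≤ k + 1 + k by omega)
        (show k + 1 + n ≤ k + 1 + k by omega) h.2
      obtain rfl : m = n := by omega
      rw [h1]
    · have := H.injOn (show i ≤ k + 1 + k by omega) (show k + 1 + n ≤ k + 1 + k by omega) h.1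
      omega

/-- A stacked polytope with two disjoint facets covering its vertices, with a polytope whose graph
is complete glued on along each of them. -/
structure IsDumbbell {k : ℕ} (v : ℕ → Space (k + 1)) (S C₁ C₂ Q P : Set (Space (k + 1))) :
    Prop where
  path : IsStackedPath (k + 1) k v S
  two_le : 2 ≤ k
  glued₁ : IsGlued (convexHull ℝ (range fun i : Fin (k + 1) => v i)) S C₁ Q
  glued₂ : IsGlued (convexHull ℝ (range fun i : Fin (k + 1) => v (k + 1 + i))) Q C₂ P
  mem₁ : ∀ i : Fin (k + 1), v i ∈ vertices C₁
  mem₂ : ∀ i : Fin (k + 1), v (k + 1 + i) ∈ vertices C₂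
  complete₁ : ∀ a ∈ vertices C₁, ∀ b ∈ vertices C₁, IsFace C₁ (segment ℝ a b)
  complete₂ : ∀ a ∈ vertices C₂, ∀ b ∈ vertices C₂, IsFace C₂ (segment ℝ a b)

namespace IsDumbbell

variable {k : ℕ} {v : ℕ → Space (k + 1)} {S C₁ C₂ Q P : Set (Space (k + 1))}

theorem one_lt_dim₁ (H : IsDumbbell v S C₁ C₂ Q P) :
    1 < dim (convexHull ℝ (range fun i : Fin (k + 1) => v i)) := by
  have := dim_facet H.glued₁
  have := H.two_le
  omega

theorem one_lt_dim₂ (H : IsDumbbell v S C₁ C₂ Q P) :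
    1 < dim (convexHull ℝ (range fun i : Fin (k + 1) => v (k + 1 + i))) := by
  have := dim_facet H.glued₂
  have := H.two_le
  omega

/-- A common point lies in `Q ∩ C₂`, the last facet of S, and then in `S ∩ C₁`, the first facet;
these two are disjoint. -/
theorem disjoint (H : IsDumbbell v S C₁ C₂ Q P) : Disjoint C₁ C₂ := by
  rw [Set.disjoint_left]
  intro x h1 h2
  have hxQ : x ∈ Q := H.glued₁.eq_union ▸ Or.inr h1
  have hx : x ∈ Q ∩ C₂ := ⟨hxQ, h2⟩
  rw [H.glued₂.inter_eq] at hx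
  have hx' : x ∈ S ∩ C₁ := ⟨IsExposed.subset H.path.last.1 hx, h1⟩
  rw [H.glued₁.inter_eq] at hx'
  exact Set.disjoint_left.1 H.path.disjoint hx' hx

theorem vertices_eq (H : IsDumbbell v S C₁ C₂ Q P) :
    vertices P = vertices C₁ ∪ vertices C₂ := by
  rw [H.glued₂.vertices_eq (zero_lt_one.trans H.one_lt_dim₂),
    H.glued₁.vertices_eq (zero_lt_one.trans H.one_lt_dim₁), union_assoc]
  refine union_eq_self_of_subset_left ?_
  rw [H.path.vertices_eq]
  rintro _ ⟨i, hi, rfl⟩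
  rcases lt_or_ge i (k + 1) with h | h
  · exact Or.inl (H.mem₁ ⟨i, h⟩)
  · right
    obtain ⟨m, rfl⟩ := Nat.exists_eq_add_of_le h
    exact H.mem₂ ⟨m, by simp only [mem_Iic] at hi; omega⟩

theorem isFace_of_left (H : IsDumbbell v S C₁ C₂ Q P) {a b : Space (k + 1)}
    (h : IsFace S (segment ℝ a b) ∨ IsFace C₁ (segment ℝ a b)) : IsFace P (segment ℝ a b) :=
  (H.glued₂.isFace_segment_iff H.one_lt_dim₂).2
    (Or.inl ((H.glued₁.isFace_segment_iff H.one_lt_dim₁).2 h))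

/-- An edge between the two ends lies in neither `C₁` nor `C₂`, hence is an edge of S; its endpoints
then lie on the two gluing facets, where the adjacency rule of the path applies. -/
theorem isFace_segment_iff (H : IsDumbbell v S C₁ C₂ Q P) {a b : Space (k + 1)}
    (ha : a ∈ vertices C₁) (hb : b ∈ vertices C₂) :
    IsFace P (segment ℝ a b) ↔
      ∃ i m, i < k + 1 ∧ m ≤ i ∧ a = v i ∧ b = v (k + 1 + m) := by
  constructor
  · intro h
    have haC := vertices_subset _ ha
    have hbC := vertices_subset _ hb
    rcases (H.glued₂.isFace_segment_iff H.one_lt_dim₂).1 h with h | h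
    swap
    · exact absurd (IsExposed.subset h (left_mem_segment ℝ a b))
        (Set.disjoint_left.1 H.disjoint haC)
    have hbF : b ∈ Q ∩ C₂ := ⟨IsExposed.subset h (right_mem_segment ℝ a b), hbC⟩
    rw [H.glued₂.inter_eq] at hbF
    rcases (H.glued₁.isFace_segment_iff H.one_lt_dim₁).1 h with h | h
    swap
    · exact absurd hbC
        (Set.disjoint_left.1 H.disjoint (IsExposed.subset h (right_mem_segment ℝ a b)))
    have haF : a ∈ S ∩ C₁ := ⟨IsExposed.subset h (left_mem_segment ℝ a b), haC⟩
    rw [H.glued₁.inter_eq] at haF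
    obtain ⟨i, rfl⟩ := mem_of_mem_vertices ((subset_convexHull ℝ _).trans
      (IsExposed.subset H.glued₁.isFacet_right.1)) ha haF
    obtain ⟨m, rfl⟩ := mem_of_mem_vertices ((subset_convexHull ℝ _).trans
      (IsExposed.subset H.glued₂.isFacet_right.1)) hb hbF
    have hi := i.2
    have hm := m.2
    have := (H.path.edge_iff i (k + 1 + m) (by omega) (by omega)).1 h
    exact ⟨i, m, hi, by omega, rfl, rfl⟩
  · rintro ⟨i, m, hi, hm, rfl, rfl⟩
    exact H.isFace_of_left (Or.inl
      ((H.path.edge_iff i (k + 1 + m) (by omega) (by omega)).2 (by omega)))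

/-- The vertices of the first of the two polytopes that are glued on. -/
def side (C₁ P : Set (Space (k + 1))) : Set (vertices P) := {x | (x : Space (k + 1)) ∈ vertices C₁}

theorem mem_compl_side (H : IsDumbbell v S C₁ C₂ Q P) {x : vertices P} :
    x ∈ (side C₁ P)ᶜ ↔ (x : Space (k + 1)) ∈ vertices C₂ := by
  have hx : (x : Space (k + 1)) ∈ vertices C₁ ∪ vertices C₂ := H.vertices_eq ▸ x.2
  constructor
  · exact fun h => hx.resolve_left h
  · exact fun h h' => Set.disjoint_left.1 H.disjoint (vertices_subset _ h') (vertices_subset _ h)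

theorem isClique_side (H : IsDumbbell v S C₁ C₂ Q P) : (graph P).IsClique (side C₁ P) :=
  fun a ha b hb hab => ⟨hab, H.isFace_of_left (Or.inr (H.complete₁ a ha b hb))⟩

theorem isClique_compl_side (H : IsDumbbell v S C₁ C₂ Q P) :
    (graph P).IsClique (side C₁ P)ᶜ := fun a ha b hb hab =>
  ⟨hab, (H.glued₂.isFace_segment_iff H.one_lt_dim₂).2
    (Or.inr (H.complete₂ a (H.mem_compl_side.1 ha) b (H.mem_compl_side.1 hb)))⟩

theorem ncard_side (H : IsDumbbell v S C₁ C₂ Q P) : (side C₁ P).ncard = (vertices C₁).ncard := by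
  rw [← ncard_image_of_injective _ Subtype.val_injective]
  congr 1
  ext x
  constructor
  · rintro ⟨y, hy, rfl⟩
    exact hy
  · exact fun hx => ⟨⟨x, H.vertices_eq ▸ Or.inl hx⟩, hx, rfl⟩

theorem ncard_compl_side (H : IsDumbbell v S C₁ C₂ Q P) :
    (side C₁ P)ᶜ.ncard = (vertices C₂).ncard := by
  rw [← ncard_image_of_injective _ Subtype.val_injective]
  congr 1
  ext x
  constructor
  · rintro ⟨y, hy, rfl⟩
    exact H.mem_compl_side.1 hy
  · exact fun hx => ⟨⟨x, H.vertices_eq ▸ Or.inr hx⟩, H.mem_compl_side.2 hx, rfl⟩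

theorem encard_crossingEdges (H : IsDumbbell v S C₁ C₂ Q P) :
    ((graph P).crossingEdges (side C₁ P)).encard = (((k + 1) ^ 2 + (k + 1)) / 2 : ℕ) := by
  rw [← H.path.encard_middle_edges,
    ← (Sym2.map.injective (Subtype.val_injective (p := (· ∈ vertices P)))).encard_image]
  congr 1
  ext e
  constructor
  · rintro ⟨_, ⟨x, hx, y, hy, hxy, rfl⟩, rfl⟩
    obtain ⟨i, m, hi, hm, h1, h2⟩ :=
      (H.isFace_segment_iff hx (H.mem_compl_side.1 hy)).1 hxy.2
    refine ⟨⟨i, m⟩, by simp; omega, ?_⟩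
    simp [h1, h2]
  · rintro ⟨⟨i, m⟩, hp, rfl⟩
    simp only [Finset.coe_sigma, Finset.coe_range, mem_sigma_iff, mem_Iio] at hp
    have h1 : v i ∈ vertices C₁ := H.mem₁ ⟨i, hp.1⟩
    have h2 : v (k + 1 + m) ∈ vertices C₂ := H.mem₂ ⟨m, by omega⟩
    have h3 := (H.isFace_segment_iff h1 h2).2 ⟨i, m, hp.1, by omega, rfl, rfl⟩
    refine ⟨s(⟨v i, H.vertices_eq ▸ Or.inl h1⟩, ⟨v (k + 1 + m), H.vertices_eq ▸ Or.inr h2⟩),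
      ⟨_, h1, _, H.mem_compl_side.2 h2, ⟨fun h => ?_, h3⟩, rfl⟩, rfl⟩
    have h4 : v i = v (k + 1 + m) := congrArg Subtype.val h
    exact Set.disjoint_left.1 H.disjoint (vertices_subset _ h1) (h4 ▸ vertices_subset _ h2)

end IsDumbbell

theorem finite_vertices {P : Set (Space d)} (hP : IsFiniteHull P) : (vertices P).Finite := by
  obtain ⟨V, hV, rfl⟩ := hP
  exact hV.subset (vertices_convexHull_subset V)

theorem exists_polytope_with_nontrivial_minimum_cut (hd : 4 ≤ d) :
    ∃ P : Set (Space d), IsSimplicial d P ∧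
      (∀ v, (d ^ 2 + d) / 2 ≤ ((graph P).neighborSet v).ncard) ∧
      (∃ D, (graph P).IsMinimumEdgeCut D ∧ ¬ (graph P).IsTrivialCut D ∧
        D.ncard = (d ^ 2 + d) / 2) ∧
      IsStackedCyclicSum P := by
  obtain ⟨k, rfl⟩ : ∃ k, d = k + 1 := ⟨d - 1, by omega⟩
  -- Needed so that N + 1 points suffice for a cyclic polytope, which must have at least d + 1.
  have hN : k + 1 ≤ ((k + 1) ^ 2 + (k + 1)) / 2 := by
    rw [Nat.le_div_iff_mul_le two_pos]
    nlinarith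
  set N := ((k + 1) ^ 2 + (k + 1)) / 2 with hNdef
  -- Stacking k = d - 1 times on a simplex gives d + 1 + k = 2d vertices.
  obtain ⟨v, S, H⟩ := IsStackedPath.exists_of_le (d := k + 1) (by omega) k
  have hT : (naturals (N + 1)).Finite := finite_range _
  set C := convexHull ℝ (momentCurve (k + 1) '' naturals (N + 1)) with hC
  have hCV : vertices C = momentCurve (k + 1) '' naturals (N + 1) := vertices_cyclic (by omega) _
  have hCF := isProperFace_cyclic (d := k + 1) (N := N + 1) (by omega) (by omega)
  have hCi : AffineIndependent ℝ fun i : Fin (k + 1) => momentCurve (k + 1) (i.val : ℝ) :=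
    affineIndependent_momentCurve (s := fun i : Fin (k + 1) => (i.val : ℝ))
      (fun i j h => Fin.ext (Nat.cast_injective h)) (by simp)
  have hCf : IsFiniteHull C := ⟨_, hT.image _, rfl⟩
  have hCm : ∀ i : Fin (k + 1), momentCurve (k + 1) (i.val : ℝ) ∈ vertices C := fun i => by
    rw [hCV]
    exact ⟨_, ⟨⟨i, by have := i.2; omega⟩, rfl⟩, rfl⟩
  obtain ⟨φ₁, hφ₁, hφu₁, G₁⟩ := exists_isGlued (by omega) H.isFiniteHull hCf H.indep_first hCi
    H.first hCF
  -- The first gluing removes only the first facet, so the last facet of S is still a proper face of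
  -- `Q`.
  have hne : convexHull ℝ (range fun i : Fin (k + 1) => v (k + 1 + i)) ≠
      convexHull ℝ (range fun i : Fin (k + 1) => v i) := fun h => by
    have h0 : v 0 ∈ convexHull ℝ (range fun i : Fin (k + 1) => v i) :=
      subset_convexHull ℝ _ ⟨0, rfl⟩
    exact Set.disjoint_left.1 H.disjoint h0 (h ▸ h0)
  obtain ⟨φ₂, hφ₂, hφu₂, G₂⟩ := exists_isGlued (by omega) G₁.isFiniteHull hCf H.indep_last hCi
    ((G₁.isProperFace_iff _).2 ⟨Or.inl H.last, hne⟩) hCF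
  set Q := S ∪ proj φ₁ '' C with hQ
  set P := Q ∪ proj φ₂ '' C with hP
  have D : IsDumbbell v S (proj φ₁ '' C) (proj φ₂ '' C) Q P :=
    { path := H
      two_le := by omega
      glued₁ := G₁
      glued₂ := G₂
      mem₁ := fun i => by
        rw [vertices_proj hφ₁, ← hφu₁ i]
        exact mem_image_of_mem _ (hCm i)
      mem₂ := fun i => by
        rw [vertices_proj hφ₂, ← hφu₂ i]
        exact mem_image_of_mem _ (hCm i)
      complete₁ := fun a ha b hb => isFace_segment_proj_cyclic hd hφ₁ ha hb
      complete₂ := fun a ha b hb => isFace_segment_proj_cyclic hd hφ₂ ha hb }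
  have hX : N + 1 ≤ (IsDumbbell.side (proj φ₁ '' C) P).ncard := by
    rw [D.ncard_side, ncard_vertices_proj_cyclic (by omega) hφ₁]
  have hXc : N + 1 ≤ (IsDumbbell.side (proj φ₁ '' C) P)ᶜ.ncard := by
    rw [D.ncard_compl_side, ncard_vertices_proj_cyclic (by omega) hφ₂]
  have hfin : Finite (vertices P) := (finite_vertices G₂.isFiniteHull).to_subtype
  have hCs : HasSimplexFaces C := hasSimplexFaces_cyclic hT
  have hPs : HasSimplexFaces P := G₂.hasSimplexFaces
    (G₁.hasSimplexFaces H.hasSimplexFaces (hasSimplexFaces_proj hCs hφ₁))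
    (hasSimplexFaces_proj hCs hφ₂)
  have hPn : P.Nonempty := ⟨v 0, Or.inl (Or.inl (vertices_subset S (H.mem_vertices (by omega))))⟩
  refine ⟨P, isSimplicial_of_hasSimplexFaces G₂.isFiniteHull hPn G₂.dim_union hPs,
    SimpleGraph.le_ncard_neighborSet_of_cliques D.isClique_side D.isClique_compl_side hX hXc,
    ⟨_, SimpleGraph.isMinimumEdgeCut_of_cliques D.isClique_side D.isClique_compl_side hX hXc
      D.encard_crossingEdges, SimpleGraph.not_isTrivialCut_of_cliques D.isClique_side
      D.isClique_compl_side hX hXc (by omega), ?_⟩, ?_⟩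
  · rw [ncard_def, D.encard_crossingEdges]
    rfl
  -- The last facet is a facet of S by comparing dimensions: it is a face of S and a facet of `Q`,
  -- and both polytopes have dimension d.
  · refine ⟨S, _, _, C, Q, H.isStacked, ?_, G₁.isFacet_left, ⟨H.last.1, G₂.isFacet_left.2.1, ?_⟩,
      H.disjoint, isCyclic_naturals (by omega), isNeighborly_cyclic (by omega) _,
      G₁.isConnectedSum (isProjectiveImage_proj hφ₁),
      G₂.isConnectedSum (isProjectiveImage_proj hφ₂)⟩
    · rw [H.vertices_eq, H.injOn.ncard_image, ← Finset.coe_Iic, ncard_coe_finset, Nat.card_Iic]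
      omega
    · rw [G₂.isFacet_left.2.2, G₂.dim_left, G₁.dim_left]

end Polytope

end

theorem mainTheorem5 :
    (∀ d : ℕ, 4 ≤ d →
      ∃ P : Set (Polytope.Space d),
        Polytope.IsSimplicial d P ∧
        (∀ v, (d ^ 2 + d) / 2 ≤ ((Polytope.graph P).neighborSet v).ncard) ∧
        (∃ D, (Polytope.graph P).IsMinimumEdgeCut D ∧ ¬ (Polytope.graph P).IsTrivialCut D ∧
          D.ncard = (d ^ 2 + d) / 2) ∧
        Polytope.IsStackedCyclicSum P) ∧
    -- for `d = 4` the bound `4 * d - 7` cannot be raised to `4 * d - 6`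
    ¬ (∀ P : Set (Polytope.Space 4), Polytope.IsSimplicial 4 P →
        ∀ D, (Polytope.graph P).IsMinimumEdgeCut D → D.ncard ≤ 4 * 4 - 6 →
          (Polytope.graph P).IsTrivialCut D) := by
  refine ⟨fun d hd => Polytope.exists_polytope_with_nontrivial_minimum_cut hd, fun h => ?_⟩
  obtain ⟨P, hP, -, ⟨D, hD, hDt, hDc⟩, -⟩ :=
    Polytope.exists_polytope_with_nontrivial_minimum_cut (d := 4) le_rfl
  exact hDt (h P hP D hD (by rw [hDc]; norm_num))
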